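/- Let $\mathbb D=\{z\in\mathbb C:|z|<1\}$. Let $\phi$ be analytic and univalent on $\mathbb D$ with $\operatorname{Re}\phi>0$, $\phi(0)=1$, $\phi'(0)>0$ and $\phi(\mathbb D)$ symmetric about the real axis, and suppose that $\phi(\mathbb D)$ is convex. Write $\phi(z)=1+B_1z+B_2z^2+\cdots$. Let $\psi$ be an analytic zero-free function on $\mathbb D$ with $$\psi(z)+\frac{z\psi'(z)}{\psi(z)}=\phi(z)\quad(z\in\mathbb D),\qquad \psi(z)=1+\sum_{m\ge1}c_mz^m .$$ Let $\mathcal C(\phi)$ be the class of analytic $f$ on $\mathbb D$ with $f(0)=0$, $f'(0)=1$, $f'\ne0$ and $1+zf''(z)/f'(z)\prec\phi(z)$, where $g\prec F$ means $g=F\circ w$ on $\mathbb D$ for some analytic $w:\mathbb D\to\mathbb D$ with $w(0)=0$. The logarithmic coefficients $\gamma_m=\gamma_m(f)$ are given by $\log\big(f(z)/z\big)=2\sum_{m\ge1}\gamma_mz^m$ near $0$, with the branch of the logarithm that vanishes at $z=0$. (1) If $\psi(\mathbb D)$ is convex, then every $f\in\mathcal C(\phi)$ satisfies $$|\gamma_m|\le\frac{|B_1|}{4m}\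 (m\ge1),\qquad \sum_{m=1}^{n}|\gamma_m|^2\le\frac14\sum_{m=1}^{n}\frac{|c_m|^2}{m^2}\ (n\in\mathbb N),\qquad \sum_{m=1}^{\infty}|\gamma_m|^2\le\frac14\sum_{m=1}^{\infty}\frac{|c_m|^2}{m^2},$$ where both infinite series converge. (2) If $\psi(\mathbb D)$ is starlike with respect to $1$, then every $f\in\mathcal C(\phi)$ satisfies $|\gamma_m|\le |B_1|/4$ for all $m\ge1$. (3) (Sharpness.) There is an analytic $f_0$ on $\mathbb D$ with $f_0(0)=0$, $f_0'(0)=1$, $f_0(z)\neq0$ for $z\ne0$, and $zf_0'(z)/f_0(z)=\psi(z)$ for $0<|z|<1$. Every such $f_0$ belongs to $\mathcal C(\phi)$ and has $\gamma_m(f_0)=c_m/(2m)$ for all $m\ge1$. In case (1), $f_0$ gives equality in the inequality between the infinite sums and in $|\gamma_m|\le|B_1|/(4m)$ for $m=1$, and for a given $m\ge1$ it gives equality in the latter exactly when $|c_m|=|B_1|/2$. In case (2), $f_0$ gives equality in $|\gamma_m|\le|B_1|/4$ for $m=1$, and for a given $m\ge1$ exactly when $|c_m|=m|B_1|/2$.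 -/

import Mathlib

noncomputable section

namespace MaMinda

/-- The open unit disk. -/
abbrev disk : Set ℂ := Metric.ball 0 1

/-- Subordination `g ≺ F` on the unit disk: `g = F ∘ w` for a Schwarz function `w`. -/
def Subordinate (g F : ℂ → ℂ) : Prop :=
  ∃ w : ℂ → ℂ, DifferentiableOn ℂ w disk ∧ w 0 = 0 ∧ (∀ z ∈ disk, w z ∈ disk) ∧
    ∀ z ∈ disk, g z = F (w z)

/-- The class of analytic functions on the disk normalized by `f 0 = 0`, `f' 0 = 1`. -/
structure Normalized (f : ℂ → ℂ) : Prop where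
  analytic : DifferentiableOn ℂ f disk
  map_zero : f 0 = 0
  deriv_zero : deriv f 0 = 1

/-- Ma-Minda functions: analytic and univalent on the disk, with positive real part, value `1`
and positive derivative at the origin, and image symmetric about the real axis. -/
structure IsMaMinda (φ : ℂ → ℂ) : Prop where
  analytic : DifferentiableOn ℂ φ disk
  univalent : Set.InjOn φ disk
  re_pos : ∀ z ∈ disk, 0 < (φ z).re
  map_zero : φ 0 = 1
  deriv_zero_re : 0 < (deriv φ 0).re
  deriv_zero_im : (deriv φ 0).im = 0
  symmetric : ∀ u ∈ φ '' disk, (starRingEnd ℂ) u ∈ φ '' disk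

/-- The Ma-Minda class of convex functions: normalized `f` with
`1 + z f''(z) / f'(z) ≺ φ(z)`, the quotient being required to make sense on the disk. -/
structure ConvexClass (φ f : ℂ → ℂ) : Prop where
  normalized : Normalized f
  deriv_ne_zero : ∀ z ∈ disk, deriv f z ≠ 0
  subordinate : Subordinate (fun z => 1 + z * deriv (deriv f) z / deriv f z) φ

/-- `ψ` is an analytic solution on the disk of `ψ + z ψ' / ψ = φ`. -/
structure BriotBouquetSolution (φ ψ : ℂ → ℂ) : Prop where
  analytic : DifferentiableOn ℂ ψ disk
  ne_zero : ∀ z ∈ disk, ψ z ≠ 0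
  equation : ∀ z ∈ disk, ψ z + z * deriv ψ z / ψ z = φ z

/-- `f` is a normalized analytic function with `z f' / f = ψ` on the punctured disk. -/
structure StarSolution (ψ f : ℂ → ℂ) : Prop where
  normalized : Normalized f
  ne_zero : ∀ z ∈ disk, z ≠ 0 → f z ≠ 0
  equation : ∀ z ∈ disk, z ≠ 0 → z * deriv f z / f z = ψ z

/-- The `m`-th Taylor coefficient at the origin. -/
def taylorCoeff (g : ℂ → ℂ) (m : ℕ) : ℂ := iteratedDeriv m g 0 / (m.factorial : ℂ)

/-- The `m`-th logarithmic coefficient `γ_m`, determined by `log (f z / z) = 2 ∑ γ_m z ^ m` near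
the origin. For normalized `f`, the function `dslope f 0` is `z ↦ f z / z` with the singularity
removed (value `1` at `0`), and the logarithm is the branch with `log 1 = 0`. -/
def logCoeff (f : ℂ → ℂ) (m : ℕ) : ℂ := taylorCoeff (fun z => Complex.log (dslope f 0 z)) m / 2

end MaMinda

end

open MaMinda

/-!
The equation `ψ + z ψ' / ψ = φ` is of Briot–Bouquet type. Since `φ` maps the disk univalently onto
a convex set in the right half-plane, Jack's lemma gives first `ψ ≺ φ` and then, applied to
`(f z / z) / f' z` and `1 / ψ`, the subordination `z f' / f ≺ ψ` for every `f ∈ C(φ)`. The latter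
needs `ψ` to be univalent. This is seen by moving `ψ` linearly to `φ`: along
`(1 - t) ψ + t φ` the roots of a fixed value move towards the origin, so two roots of `ψ` would
survive, distinct, up to `t = 1`.

The number `2 m γ_m` is the `m`-th Taylor coefficient of `z f' / f`, so what remains are coefficient
bounds for functions `g ≺ ψ`: Rogosinski's inequality and summation by parts for the square sums,
averaging over the rotations of order `m` when `ψ` has convex image, and, when the image is
starlike, the representation `ψ z = ψ 0 + z h(z)²`, where Clunie's method bounds the coefficients
of `h` by `‖h 0‖`. For the extremal function, `z f' / f` is `ψ` itself.
-/

namespace MaMinda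

open Set Metric Filter Topology

variable {F G R f g h v η ω φ ψ : ℂ → ℂ} {z ζ a c : ℂ} {U V K : Set ℂ} {r : ℝ} {j m n : ℕ}

/-! ### Boundary derivatives and Jack's lemma -/

theorem eventually_lt_of_hasDerivAt_neg {x : ℝ → ℝ} {v t : ℝ} (hx : HasDerivAt x v t)
    (hv : v < 0) : ∀ᶠ s in 𝓝[>] t, x s < x t := by
  have hslope : Tendsto (slope x t) (𝓝[>] t) (𝓝 v) :=
    (hasDerivAt_iff_tendsto_slope.1 hx).mono_left (nhdsGT_le_nhdsNE t)
  filter_upwards [hslope.eventually_lt_const hv, self_mem_nhdsWithin] with s hs hts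
  rw [slope_def_field, div_lt_iff₀ (sub_pos.2 hts), zero_mul] at hs
  exact sub_neg.1 hs

theorem hasDerivAt_nonpos_of_eventually_le {x : ℝ → ℝ} {v t : ℝ} (hx : HasDerivAt x v t)
    (hle : ∀ᶠ s in 𝓝[>] t, x s ≤ x t) : v ≤ 0 := by
  by_contra! hv
  obtain ⟨s, hs, hs'⟩ :=
    ((eventually_lt_of_hasDerivAt_neg hx.neg (neg_lt_zero.2 hv)).and hle).exists
  exact hs'.not_gt (neg_lt_neg_iff.1 hs)

theorem hasDerivAt_re_nonpos_of_eventually_re_le {x : ℝ → ℂ} {v : ℂ} {t : ℝ}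
    (hx : HasDerivAt x v t) (hle : ∀ᶠ s in 𝓝[>] t, (x s).re ≤ (x t).re) : v.re ≤ 0 :=
  hasDerivAt_nonpos_of_eventually_le (Complex.reCLM.hasFDerivAt.comp_hasDerivAt t hx) hle

theorem exists_nonneg_mul_deriv_eq (hf : DifferentiableAt ℂ f ζ)
    (hmax : ∀ z, ‖z‖ ≤ ‖ζ‖ → (f z).re ≤ (f ζ).re) :
    ∃ k : ℝ, 0 ≤ k ∧ ζ * deriv f ζ = k := by
  have hdir (c : ℂ) (hc : c.re ≤ 0) : (c * (ζ * deriv f ζ)).re ≤ 0 := by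
    have hcurve : HasDerivAt (fun τ : ℝ => ζ * Complex.exp (c * τ)) (ζ * c) 0 := by
      simpa using ((((hasDerivAt_id ((0 : ℝ) : ℂ)).const_mul c).cexp).const_mul ζ).comp_ofReal
    have hcomp : HasDerivAt (fun τ : ℝ => f (ζ * Complex.exp (c * τ))) (deriv f ζ * (ζ * c)) 0 :=
      HasDerivAt.comp (0 : ℝ) (by simpa using hf.hasDerivAt) hcurve
    have hre := hasDerivAt_re_nonpos_of_eventually_re_le hcomp (by
      filter_upwards [self_mem_nhdsWithin] with τ hτ
      have hexp : ‖Complex.exp (c * τ)‖ ≤ 1 := by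
        rw [Complex.norm_exp, Real.exp_le_one_iff, Complex.re_mul_ofReal]
        exact mul_nonpos_of_nonpos_of_nonneg hc (le_of_lt hτ)
      simpa using hmax _ (by simpa using mul_le_of_le_one_right (norm_nonneg ζ) hexp))
    convert hre using 2
    ring
  have hre := hdir (-1) (by simp)
  have him := hdir Complex.I (by simp)
  have him' := hdir (-Complex.I) (by simp)
  simp only [neg_mul, one_mul, Complex.neg_re, Complex.I_mul_re] at hre him him'
  exact ⟨(ζ * deriv f ζ).re, by linarith, Complex.ext rfl (by rw [Complex.ofReal_im]; linarith)⟩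

theorem dslope_zero_eq_div (h0 : f 0 = 0) (hz : z ≠ 0) : dslope f 0 z = f z / z := by
  rw [dslope_of_ne f hz, slope_def_field, h0, sub_zero, sub_zero]

/-- **Jack's lemma**. -/
theorem exists_one_le_mul_deriv_eq (hω : DifferentiableOn ℂ ω (ball 0 ‖ζ‖))
    (hωζ : DifferentiableAt ℂ ω ζ) (h0 : ω 0 = 0) (hζ : ζ ≠ 0) (hne : ω ζ ≠ 0)
    (hmax : ∀ z, ‖z‖ ≤ ‖ζ‖ → ‖ω z‖ ≤ ‖ω ζ‖) :
    ∃ k : ℝ, 1 ≤ k ∧ ζ * deriv ω ζ = k * ω ζ := by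
  have hquot (z : ℂ) (hz : ‖z‖ ≤ ‖ζ‖) : ‖dslope ω 0 z‖ ≤ ‖ω ζ‖ / ‖ζ‖ := by
    rcases hz.lt_or_eq with hlt | heq
    · refine Complex.norm_dslope_le_div_of_mapsTo_ball hω (fun y hy => ?_)
        (mem_ball_zero_iff.2 hlt)
      simpa [h0] using hmax y (mem_ball_zero_iff.1 hy).le
    · rw [dslope_zero_eq_div h0 (norm_ne_zero_iff.1 (heq ▸ norm_ne_zero_iff.2 hζ)), norm_div, heq]
      gcongr
      exact hmax z hz
  have hderiv : HasDerivAt (fun z => dslope ω 0 z / (ω ζ / ζ))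
      ((deriv ω ζ * ζ - ω ζ * 1) / ζ ^ 2 / (ω ζ / ζ)) ζ := by
    refine ((hωζ.hasDerivAt.div (hasDerivAt_id ζ) hζ).congr_of_eventuallyEq ?_).div_const _
    filter_upwards [isOpen_ne.mem_nhds hζ] with z hz using dslope_zero_eq_div h0 hz
  -- Jack's lemma is the first-order condition at `ζ` for the quotient `ω z / z`.
  obtain ⟨k, hk, hkeq⟩ := exists_nonneg_mul_deriv_eq hderiv.differentiableAt fun z hz => by
    rw [dslope_zero_eq_div h0 hζ, div_self (div_ne_zero hne hζ), Complex.one_re]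
    refine (Complex.re_le_norm _).trans ?_
    rw [norm_div, norm_div]
    exact div_le_one_of_le₀ (hquot z hz) (by positivity)
  refine ⟨k + 1, by linarith, ?_⟩
  rw [hderiv.deriv] at hkeq
  push_cast
  rw [← hkeq]
  field_simp
  ring

/-! ### Univalent functions -/

/-- `F` is univalent, that is, analytic and injective, on the open set `U`. -/
structure UnivalentOn (F : ℂ → ℂ) (U : Set ℂ) : Prop where
  isOpen : IsOpen U
  analytic : DifferentiableOn ℂ F U
  injOn : InjOn F U

namespace UnivalentOn

theorem not_eventually_eq (hF : UnivalentOn F U) (ha : a ∈ U) : ¬∀ᶠ z in 𝓝 a, F z = F a := by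
  intro hconst
  have hpunct : ∀ᶠ z in 𝓝[≠] a, z = a := by
    filter_upwards [nhdsWithin_le_nhds hconst, nhdsWithin_le_nhds (hF.isOpen.mem_nhds ha)]
      with z hz hzU using hF.injOn hzU ha hz
  obtain ⟨z, hz, hza⟩ := (hpunct.and self_mem_nhdsWithin).exists
  exact hza hz

theorem image_mem_nhds (hF : UnivalentOn F U) (ha : a ∈ U) (hV : V ∈ 𝓝 a) :
    F '' V ∈ 𝓝 (F a) :=
  (((hF.analytic.analyticAt
    (hF.isOpen.mem_nhds ha)).eventually_constant_or_nhds_le_map_nhds).resolve_left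
    (hF.not_eventually_eq ha)) (image_mem_map hV)

theorem isOpen_image (hF : UnivalentOn F U) : IsOpen (F '' U) := by
  rw [isOpen_iff_mem_nhds]
  rintro _ ⟨z, hz, rfl⟩
  exact hF.image_mem_nhds hz (hF.isOpen.mem_nhds hz)

theorem invFunOn_apply (hF : UnivalentOn F U) (ha : a ∈ U) : Function.invFunOn F U (F a) = a :=
  hF.injOn.leftInvOn_invFunOn ha

theorem continuousAt_invFunOn (hF : UnivalentOn F U) (ha : a ∈ U) :
    ContinuousAt (Function.invFunOn F U) (F a) := by
  intro V hV
  rw [hF.invFunOn_apply ha] at hV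
  rw [mem_map]
  filter_upwards [hF.image_mem_nhds ha (inter_mem hV (hF.isOpen.mem_nhds ha))]
  rintro _ ⟨z, ⟨hzV, hzU⟩, rfl⟩
  rwa [mem_preimage, hF.invFunOn_apply hzU]

theorem hasDerivAt_invFunOn_of_deriv_ne_zero (hF : UnivalentOn F U) (ha : a ∈ U)
    (hne : deriv F a ≠ 0) : HasDerivAt (Function.invFunOn F U) (deriv F a)⁻¹ (F a) := by
  refine HasDerivAt.of_local_left_inverse (f := F) (hF.continuousAt_invFunOn ha) ?_ hne ?_
  · rw [hF.invFunOn_apply ha]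
    exact (hF.analytic.differentiableAt (hF.isOpen.mem_nhds ha)).hasDerivAt
  · filter_upwards [hF.isOpen_image.mem_nhds (mem_image_of_mem F ha)] with y hy
    using Function.invFunOn_eq hy

theorem eventually_deriv_ne_zero (hF : UnivalentOn F U) (ha : a ∈ U) :
    ∀ᶠ z in 𝓝[≠] a, deriv F z ≠ 0 := by
  have hUa := hF.isOpen.mem_nhds ha
  refine ((hF.analytic.analyticAt hUa).deriv.eventually_eq_zero_or_eventually_ne_zero).resolve_left
    fun hzero => hF.not_eventually_eq ha ?_
  obtain ⟨ε, hε, hball⟩ := Metric.eventually_nhds_iff_ball.1 (hzero.and hUa)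
  filter_upwards [ball_mem_nhds a hε] with z hz
  exact isOpen_ball.is_const_of_deriv_eq_zero (convex_ball a ε).isPreconnected
    (fun w hw => (hF.analytic.differentiableAt
      (hF.isOpen.mem_nhds (hball w hw).2)).differentiableWithinAt)
    (fun w hw => (hball w hw).1) hz (mem_ball_self hε)

theorem deriv_ne_zero (hF : UnivalentOn F U) (ha : a ∈ U) : deriv F a ≠ 0 := by
  intro hzero
  have hUa := hF.isOpen.mem_nhds ha
  -- The inverse has a removable singularity at `F a`.
  have hinv : ∀ᶠ y in 𝓝[≠] F a, DifferentiableAt ℂ (Function.invFunOn F U) y := by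
    have hmem := eventually_nhdsWithin_iff.1 (hF.eventually_deriv_ne_zero ha)
    filter_upwards [nhdsWithin_le_nhds (hF.image_mem_nhds ha (inter_mem hUa hmem)),
      self_mem_nhdsWithin]
    rintro _ ⟨z, ⟨hzU, hz⟩, rfl⟩ hne
    exact (hF.hasDerivAt_invFunOn_of_deriv_ne_zero hzU
      (hz (ne_of_apply_ne F hne))).differentiableAt
  have hinva := (Complex.analyticAt_of_differentiable_on_punctured_nhds_of_continuousAt hinv
    (hF.continuousAt_invFunOn ha)).differentiableAt.hasDerivAt
  have hid := hinva.comp a (hF.analytic.differentiableAt hUa).hasDerivAt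
  rw [hzero, mul_zero] at hid
  refine zero_ne_one (hid.unique ((hasDerivAt_id a).congr_of_eventuallyEq ?_))
  filter_upwards [hUa] with z hz using hF.invFunOn_apply hz

theorem hasDerivAt_invFunOn (hF : UnivalentOn F U) (ha : a ∈ U) :
    HasDerivAt (Function.invFunOn F U) (deriv F a)⁻¹ (F a) :=
  hF.hasDerivAt_invFunOn_of_deriv_ne_zero ha (hF.deriv_ne_zero ha)

theorem differentiableOn_invFunOn (hF : UnivalentOn F U) :
    DifferentiableOn ℂ (Function.invFunOn F U) (F '' U) := by
  rintro _ ⟨z, hz, rfl⟩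
  exact (hF.hasDerivAt_invFunOn hz).differentiableAt.differentiableWithinAt

end UnivalentOn

/-! ### Schwarz functions and subordination -/

theorem mem_disk : z ∈ disk ↔ ‖z‖ < 1 := mem_ball_zero_iff

theorem zero_mem_disk : (0 : ℂ) ∈ disk := mem_ball_self one_pos

theorem disk_mem_nhds (hz : z ∈ disk) : disk ∈ 𝓝 z := isOpen_ball.mem_nhds hz

theorem differentiableAt_of_mem_disk (hg : DifferentiableOn ℂ g disk) (hz : z ∈ disk) :
    DifferentiableAt ℂ g z :=
  hg.differentiableAt (disk_mem_nhds hz)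

theorem analyticAt_of_mem_disk (hg : DifferentiableOn ℂ g disk) (hz : z ∈ disk) :
    AnalyticAt ℂ g z :=
  hg.analyticAt (disk_mem_nhds hz)

/-- A Schwarz function: an analytic self-map of the unit disk fixing the origin. These are the
functions `w` occurring in `Subordinate`. -/
structure IsSchwarz (ω : ℂ → ℂ) : Prop where
  analytic : DifferentiableOn ℂ ω disk
  map_zero : ω 0 = 0
  mapsTo : MapsTo ω disk disk

theorem subordinate_iff : Subordinate g F ↔ ∃ ω, IsSchwarz ω ∧ EqOn g (F ∘ ω) disk :=
  ⟨fun ⟨ω, hω, h0, hmaps, heq⟩ => ⟨ω, ⟨hω, h0, hmaps⟩, heq⟩,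
    fun ⟨ω, hω, heq⟩ => ⟨ω, hω.analytic, hω.map_zero, hω.mapsTo, heq⟩⟩

theorem IsSchwarz.norm_le (hω : IsSchwarz ω) (hz : z ∈ disk) : ‖ω z‖ ≤ ‖z‖ :=
  Complex.norm_le_norm_of_mapsTo_ball hω.analytic
    (hω.mapsTo.mono_right ball_subset_closedBall) hω.map_zero (mem_disk.1 hz)

theorem UnivalentOn.subordinate_of_mapsTo (hF : UnivalentOn F disk)
    (hg : DifferentiableOn ℂ g disk) (h0 : g 0 = F 0) (hmaps : MapsTo g disk (F '' disk)) :
    Subordinate g F :=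
  ⟨Function.invFunOn F disk ∘ g, hF.differentiableOn_invFunOn.comp hg hmaps,
    by rw [Function.comp_apply, h0, hF.invFunOn_apply zero_mem_disk],
    fun _ hz => Function.invFunOn_mem (hmaps hz),
    fun _ hz => (Function.invFunOn_eq (hmaps hz)).symm⟩

/-! ### Admissibility criterion for subordination -/

theorem exists_norm_lt_and_mul_deriv_eq (hω : DifferentiableOn ℂ ω (ball 0 r)) (h0 : ω 0 = 0)
    (hz : z ∈ ball 0 r) (hlt : ‖z‖ < ‖ω z‖) :
    ∃ ζ ∈ ball 0 r, ‖ζ‖ < ‖ω ζ‖ ∧ ∃ k : ℝ, 1 ≤ k ∧ ζ * deriv ω ζ = k * ω ζ := by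
  have hsub : closedBall (0 : ℂ) ‖z‖ ⊆ ball 0 r := closedBall_subset_ball (mem_ball_zero_iff.1 hz)
  obtain ⟨ζ, hζ, hmax⟩ := (isCompact_closedBall (0 : ℂ) ‖z‖).exists_isMaxOn
    ⟨z, mem_closedBall_zero_iff.2 le_rfl⟩ (hω.continuousOn.mono hsub).norm
  have hle : ‖ζ‖ ≤ ‖z‖ := mem_closedBall_zero_iff.1 hζ
  have hζlt : ‖ζ‖ < ‖ω ζ‖ :=
    (hle.trans_lt hlt).trans_le (hmax (mem_closedBall_zero_iff.2 le_rfl))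
  have hne : ω ζ ≠ 0 := norm_pos_iff.1 ((norm_nonneg ζ).trans_lt hζlt)
  refine ⟨ζ, hsub hζ, hζlt, exists_one_le_mul_deriv_eq (hω.mono ?_)
    (hω.differentiableAt (isOpen_ball.mem_nhds (hsub hζ))) h0 ?_ hne
    fun y hy => hmax (mem_closedBall_zero_iff.2 (hy.trans hle))⟩
  · exact ball_subset_ball (hle.trans (mem_ball_zero_iff.1 hz).le)
  · rintro rfl
    exact hne h0

theorem UnivalentOn.norm_invFunOn_comp_le (hF : UnivalentOn F disk)
    (hg : DifferentiableOn ℂ g (ball 0 r)) (h0 : g 0 = F 0)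
    (hmaps : MapsTo g (ball 0 r) (F '' disk))
    (hadm : ∀ z ∈ ball 0 r, ∀ ζ ∈ disk, ∀ k : ℝ, ‖z‖ < ‖ζ‖ → 1 ≤ k → g z = F ζ →
      z * deriv g z ≠ k * (ζ * deriv F ζ)) (hz : z ∈ ball 0 r) :
    ‖Function.invFunOn F disk (g z)‖ ≤ ‖z‖ := by
  set ω : ℂ → ℂ := fun x => Function.invFunOn F disk (g x) with hωdef
  have hω : DifferentiableOn ℂ ω (ball 0 r) := hF.differentiableOn_invFunOn.comp hg hmaps
  have hω0 : ω 0 = 0 := by simp only [hωdef, h0, hF.invFunOn_apply zero_mem_disk]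
  by_contra! hlt
  obtain ⟨y, hy, hylt, k, hk, hkeq⟩ := exists_norm_lt_and_mul_deriv_eq hω hω0 hz hlt
  have hωy : ω y ∈ disk := Function.invFunOn_mem (hmaps hy)
  have hgF (x : ℂ) (hx : x ∈ ball 0 r) : g x = F (ω x) := (Function.invFunOn_eq (hmaps hx)).symm
  have hderiv : HasDerivAt g (deriv F (ω y) * deriv ω y) y := by
    refine ((differentiableAt_of_mem_disk hF.analytic hωy).hasDerivAt.comp y
      (hω.differentiableAt (isOpen_ball.mem_nhds hy)).hasDerivAt).congr_of_eventuallyEq ?_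
    filter_upwards [isOpen_ball.mem_nhds hy] with x hx using hgF x hx
  refine hadm y hy (ω y) hωy k hylt hk (hgF y hy) ?_
  rw [hderiv.deriv]
  linear_combination deriv F (ω y) * hkeq

theorem exists_notMem_and_mapsTo_ball (hg : ContinuousOn g (closedBall 0 r))
    (hV : IsOpen V) (hz : z ∈ closedBall 0 r) (hzV : g z ∉ V) :
    ∃ ζ ∈ closedBall 0 r, g ζ ∉ V ∧ MapsTo g (ball 0 ‖ζ‖) V := by
  have hclosed : IsClosed (closedBall (0 : ℂ) r ∩ g ⁻¹' Vᶜ) :=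
    hg.preimage_isClosed_of_isClosed isClosed_closedBall hV.isClosed_compl
  obtain ⟨ζ, ⟨hζ, hζV⟩, hmin⟩ := ((isCompact_closedBall (0 : ℂ) r).of_isClosed_subset hclosed
    inter_subset_left).exists_isMinOn ⟨z, hz, hzV⟩ continuous_norm.continuousOn
  refine ⟨ζ, hζ, hζV, fun y hy => ?_⟩
  rw [mem_ball_zero_iff] at hy
  by_contra hyV
  rw [mem_closedBall_zero_iff] at hζ
  exact hy.not_ge (hmin ⟨mem_closedBall_zero_iff.2 (hy.le.trans hζ), hyV⟩)

theorem UnivalentOn.subordinate_of_mul_deriv_ne (hF : UnivalentOn F disk)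
    (hg : DifferentiableOn ℂ g disk) (h0 : g 0 = F 0)
    (hadm : ∀ z ∈ disk, ∀ ζ ∈ disk, ∀ k : ℝ, ‖z‖ < ‖ζ‖ → 1 ≤ k → g z = F ζ →
      z * deriv g z ≠ k * (ζ * deriv F ζ)) : Subordinate g F := by
  refine hF.subordinate_of_mapsTo hg h0 fun z₁ hz₁ => ?_
  by_contra hz₁F
  obtain ⟨z, hz, hzF, hmaps⟩ := exists_notMem_and_mapsTo_ball
    (hg.continuousOn.mono (closedBall_subset_ball (mem_disk.1 hz₁))) hF.isOpen_image
    (mem_closedBall_zero_iff.2 le_rfl) hz₁F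
  have hz1 : ‖z‖ < 1 := (mem_closedBall_zero_iff.1 hz).trans_lt (mem_disk.1 hz₁)
  have hz0 : ‖z‖ ≠ 0 := by
    rw [norm_ne_zero_iff]
    rintro rfl
    exact hzF ⟨0, zero_mem_disk, h0.symm⟩
  have hsub : ball (0 : ℂ) ‖z‖ ⊆ disk := ball_subset_ball hz1.le
  have hsmall : MapsTo g (ball 0 ‖z‖) (F '' closedBall 0 ‖z‖) := fun y hy => by
    refine ⟨_, mem_closedBall_zero_iff.2 ?_, Function.invFunOn_eq (hmaps hy)⟩
    exact (hF.norm_invFunOn_comp_le (hg.mono hsub) h0 hmaps (fun x hx => hadm x (hsub hx)) hy).trans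
      (mem_ball_zero_iff.1 hy).le
  have hcompact : IsCompact (F '' closedBall 0 ‖z‖) :=
    (isCompact_closedBall _ _).image_of_continuousOn
      (hF.analytic.continuousOn.mono (closedBall_subset_ball hz1))
  have hmem := hsmall.closure_of_continuousOn
    (by rw [closure_ball 0 hz0]; exact hg.continuousOn.mono (closedBall_subset_ball hz1))
  rw [closure_ball 0 hz0, hcompact.isClosed.closure_eq] at hmem
  exact hzF (image_mono (closedBall_subset_ball hz1) (hmem (mem_closedBall_zero_iff.2 le_rfl)))

/-! ### Outward directions at the image of a circle -/

namespace UnivalentOn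

-- Pulling the segments back by `F` gives Schwarz functions, which cannot increase `‖ζ‖`.
theorem re_sub_div_nonpos_of_segment_subset (hF : UnivalentOn F disk)
    (hG : DifferentiableOn ℂ G disk) (h0 : G 0 = F 0)
    (hseg : ∀ x ∈ disk, segment ℝ (F x) (G x) ⊆ F '' disk) (hζ : ζ ∈ disk) (hζ0 : ζ ≠ 0) :
    ((G ζ - F ζ) / (ζ * deriv F ζ)).re ≤ 0 := by
  set L : ℝ → ℂ → ℂ := fun t x => AffineMap.lineMap (F x) (G x) t with hL
  have hmaps (t : ℝ) (ht : t ∈ Icc (0 : ℝ) 1) : MapsTo (L t) disk (F '' disk) := fun x hx =>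
    hseg x hx (by rw [segment_eq_image_lineMap]; exact mem_image_of_mem _ ht)
  have hL0 : L 0 ζ = F ζ := AffineMap.lineMap_apply_zero _ _
  have hinv : HasDerivAt (Function.invFunOn F disk) (deriv F ζ)⁻¹ (L 0 ζ) := by
    rw [hL0]
    exact hF.hasDerivAt_invFunOn hζ
  have hline : HasDerivAt (fun t => L t ζ) (G ζ - F ζ) (0 : ℝ) := AffineMap.hasDerivAt_lineMap
  have hcurve : HasDerivAt (fun t : ℝ => Function.invFunOn F disk (L t ζ) / ζ)
      ((deriv F ζ)⁻¹ * (G ζ - F ζ) / ζ) 0 :=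
    (hinv.comp (h := fun t => L t ζ) (0 : ℝ) hline).div_const ζ
  have hre := hasDerivAt_re_nonpos_of_eventually_re_le hcurve (by
    filter_upwards [Ioo_mem_nhdsGT (zero_lt_one' ℝ)] with t ht
    have hpull := Complex.norm_le_norm_of_mapsTo_ball (R := 1) (z := ζ)
      (f := fun x => Function.invFunOn F disk (L t x))
      (hF.differentiableOn_invFunOn.comp (by
        simp only [hL, AffineMap.lineMap_apply_module]
        exact (hF.analytic.const_smul _).add (hG.const_smul _))
        (hmaps t (Ioo_subset_Icc_self ht)))
      (fun x hx => ball_subset_closedBall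
        (Function.invFunOn_mem (hmaps t (Ioo_subset_Icc_self ht) hx)))
      (by simp only [hL, h0, AffineMap.lineMap_same_apply, hF.invFunOn_apply zero_mem_disk])
      (mem_disk.1 hζ)
    rw [hL0, hF.invFunOn_apply hζ, div_self hζ0, Complex.one_re]
    refine (Complex.re_le_norm _).trans ?_
    rw [norm_div]
    exact div_le_one_of_le₀ hpull (norm_nonneg ζ))
  convert hre using 2
  rw [div_mul_eq_div_div, inv_mul_eq_div, div_right_comm]

theorem re_sub_div_nonpos_of_starConvex (hF : UnivalentOn F disk)
    (hstar : StarConvex ℝ (F 0) (F '' disk)) (hζ : ζ ∈ disk) (hζ0 : ζ ≠ 0) :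
    ((F 0 - F ζ) / (ζ * deriv F ζ)).re ≤ 0 :=
  hF.re_sub_div_nonpos_of_segment_subset (G := fun _ => F 0) (differentiableOn_const _) rfl
    (fun x hx => segment_symm ℝ (F 0) (F x) ▸
      starConvex_iff_segment_subset.1 hstar (mem_image_of_mem F hx)) hζ hζ0

theorem re_sub_div_nonpos_of_convex (hF : UnivalentOn F disk) (hconv : Convex ℝ (F '' disk))
    (hζ : ζ ∈ disk) (hζ0 : ζ ≠ 0) (hz : ‖z‖ ≤ ‖ζ‖) :
    ((F z - F ζ) / (ζ * deriv F ζ)).re ≤ 0 := by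
  have hmaps : MapsTo (fun x => z / ζ * x) disk disk := fun x hx => by
    rw [mem_disk] at hx ⊢
    rw [norm_mul, norm_div]
    exact (mul_le_of_le_one_left (norm_nonneg x)
      (div_le_one_of_le₀ hz (norm_nonneg ζ))).trans_lt hx
  have hle := hF.re_sub_div_nonpos_of_segment_subset (G := fun x => F (z / ζ * x))
    (hF.analytic.comp (by fun_prop) hmaps) (by rw [mul_zero])
    (fun x hx => hconv.segment_subset (mem_image_of_mem F hx) (mem_image_of_mem F (hmaps hx)))
    hζ hζ0
  rwa [div_mul_cancel₀ z hζ0] at hle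

theorem re_sub_div_neg_of_convex (hF : UnivalentOn F disk) (hconv : Convex ℝ (F '' disk))
    (hζ : ζ ∈ disk) (hz : ‖z‖ < ‖ζ‖) : ((F z - F ζ) / (ζ * deriv F ζ)).re < 0 := by
  have hζ0 : ζ ≠ 0 := norm_pos_iff.1 ((norm_nonneg z).trans_lt hz)
  have hd : ζ * deriv F ζ ≠ 0 := mul_ne_zero hζ0 (hF.deriv_ne_zero hζ)
  have hnhds : F '' ball 0 ‖ζ‖ ∈ 𝓝 (F z) :=
    hF.image_mem_nhds (mem_disk.2 (hz.trans (mem_disk.1 hζ)))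
      (isOpen_ball.mem_nhds (mem_ball_zero_iff.2 hz))
  have htend : Tendsto (fun δ : ℝ => F z + δ * (ζ * deriv F ζ)) (𝓝[>] 0) (𝓝 (F z)) := by
    have hcont : Continuous fun δ : ℝ => F z + δ * (ζ * deriv F ζ) := by fun_prop
    simpa using (hcont.tendsto 0).mono_left nhdsWithin_le_nhds
  -- Since `F z` is interior, a small outward displacement of it still satisfies the weak bound.
  obtain ⟨δ, ⟨x, hx, hxδ⟩, hδ⟩ := ((htend.eventually hnhds).and self_mem_nhdsWithin).exists
  have hle := hF.re_sub_div_nonpos_of_convex hconv hζ hζ0 (mem_ball_zero_iff.1 hx).le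
  rw [hxδ, add_sub_right_comm, add_div, mul_div_cancel_right₀ _ hd, Complex.add_re,
    Complex.ofReal_re] at hle
  linarith [show 0 < δ from hδ]

end UnivalentOn

/-! ### Univalence along a linear chain -/

theorem exists_implicit_branch {𝕜 : Type*} [RCLike 𝕜] {f : 𝕜 × 𝕜 → 𝕜} {p q t a : 𝕜}
    (hf : HasStrictFDerivAt f
      (p • ContinuousLinearMap.fst 𝕜 𝕜 𝕜 + q • ContinuousLinearMap.snd 𝕜 𝕜 𝕜) (t, a))
    (hq : q ≠ 0) :
    ∃ α : 𝕜 → 𝕜, HasDerivAt α (-(p / q)) t ∧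
      ∀ᶠ v : 𝕜 × 𝕜 in 𝓝 (t, a), f v = f (t, a) ↔ α v.1 = v.2 := by
  let E : 𝕜 ≃L[𝕜] 𝕜 := ContinuousLinearEquiv.unitsEquivAut 𝕜 (Units.mk0 q hq)
  have hE (x : 𝕜) : E x = x * q := rfl
  have hcomp : (p • ContinuousLinearMap.fst 𝕜 𝕜 𝕜 + q • ContinuousLinearMap.snd 𝕜 𝕜 𝕜) ∘L
      ContinuousLinearMap.inr 𝕜 𝕜 𝕜 = (E : 𝕜 →L[𝕜] 𝕜) := by
    ext
    simp [hE]
  have hinv := (⟨E, hcomp.symm⟩ : ContinuousLinearMap.IsInvertible (_ ∘L _))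
  refine ⟨hf.implicitFunctionOfProdDomain hinv, ?_,
    hf.eventually_apply_eq_iff_implicitFunctionOfProdDomain hinv⟩
  refine (hf.hasStrictFDerivAt_implicitFunctionOfProdDomain hinv).hasFDerivAt.hasDerivAt.congr_deriv
    ?_
  have hEsymm (x : 𝕜) : E.symm x = x / q := by
    rw [ContinuousLinearEquiv.symm_apply_eq, hE, div_mul_cancel₀ _ hq]
  rw [hcomp]
  simp [ContinuousLinearMap.inverse_equiv, hEsymm, div_eq_mul_inv]

/-- The linear chain that joins `g`, at time `0`, to `F`, at time `1`. The time is complex so that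
the holomorphic implicit function theorem applies. -/
def chain (g F : ℂ → ℂ) (t z : ℂ) : ℂ := (1 - t) * g z + t * F z

theorem hasStrictFDerivAt_chain (hg : AnalyticAt ℂ g a) (hF : AnalyticAt ℂ F a) (t : ℂ) :
    HasStrictFDerivAt (fun v : ℂ × ℂ => chain g F v.1 v.2)
      ((F a - g a) • ContinuousLinearMap.fst ℂ ℂ ℂ +
        ((1 - t) * deriv g a + t * deriv F a) • ContinuousLinearMap.snd ℂ ℂ ℂ) (t, a) := by
  have hsnd {G : ℂ → ℂ} (hG : AnalyticAt ℂ G a) : HasStrictFDerivAt (fun v : ℂ × ℂ => G v.2)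
      (deriv G a • ContinuousLinearMap.snd ℂ ℂ ℂ) (t, a) :=
    HasStrictDerivAt.comp_hasStrictFDerivAt (t, a) hG.hasStrictDerivAt hasStrictFDerivAt_snd
  have hfst : HasStrictFDerivAt (fun v : ℂ × ℂ => v.1) (ContinuousLinearMap.fst ℂ ℂ ℂ) (t, a) :=
    hasStrictFDerivAt_fst
  refine (((hfst.const_sub 1).mul (hsnd hg)).add (hfst.mul (hsnd hF))).congr_fderiv ?_
  ext
  · simp
    ring
  · simp

theorem exists_chain_branch (hg : AnalyticAt ℂ g a) (hF : AnalyticAt ℂ F a) {t : ℝ}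
    (hne : (1 - t) * deriv g a + t * deriv F a ≠ 0) :
    ∃ α : ℝ → ℂ, HasDerivAt α (-((F a - g a) / ((1 - t) * deriv g a + t * deriv F a))) t ∧
      ∀ᶠ v : ℝ × ℂ in 𝓝 (t, a), chain g F v.1 v.2 = chain g F t a ↔ α v.1 = v.2 := by
  obtain ⟨α, hα, hiff⟩ := exists_implicit_branch (hasStrictFDerivAt_chain hg hF t) hne
  refine ⟨fun τ => α τ, hα.comp_ofReal, ?_⟩
  have hcast : Continuous fun v : ℝ × ℂ => ((v.1 : ℂ), v.2) := by fun_prop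
  exact (hcast.tendsto (t, a)).eventually hiff

-- The real part condition says that `‖α τ‖` decreases at `τ = t` along the branch `α` of roots.
theorem exists_chain_branch_norm_le (hg : AnalyticAt ℂ g a) (hF : AnalyticAt ℂ F a)
    (h0 : g 0 = F 0) {t : ℝ} (hne : (1 - t) * deriv g a + t * deriv F a ≠ 0)
    (hpos : a ≠ 0 → 0 < ((F a - g a) / (a * ((1 - t) * deriv g a + t * deriv F a))).re) :
    ∃ α : ℝ → ℂ, ContinuousAt α t ∧ α t = a ∧
      ∀ᶠ τ : ℝ in 𝓝[>] t, ‖α τ‖ ≤ ‖a‖ ∧ chain g F τ (α τ) = chain g F t a := by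
  obtain ⟨α, hα, hiff⟩ := exists_chain_branch hg hF hne
  have hαt : α t = a := hiff.self_of_nhds.1 rfl
  have hroot : ∀ᶠ τ in 𝓝[>] t, chain g F (τ : ℝ) (α τ) = chain g F t a := by
    have hgraph := (continuousAt_id.prodMk hα.continuousAt).tendsto
    rw [id, hαt] at hgraph
    filter_upwards [nhdsWithin_le_nhds (hgraph.eventually hiff)] with τ hτ using hτ.2 rfl
  refine ⟨α, hα.continuousAt, hαt, ?_⟩
  rcases eq_or_ne a 0 with rfl | ha
  · have hconst : Tendsto (fun τ : ℝ => (τ, (0 : ℂ))) (𝓝 t) (𝓝 (t, 0)) :=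
      (Continuous.prodMk_left (0 : ℂ)).tendsto t
    filter_upwards [hroot, nhdsWithin_le_nhds (hconst.eventually hiff)] with τ hτ hτ0
    have hατ : α τ = 0 := hτ0.1 (by simp only [chain, h0]; ring)
    exact ⟨hατ ▸ le_rfl, hτ⟩
  · have hneg : 2 * inner ℝ (α t)
        (-((F a - g a) / ((1 - t) * deriv g a + t * deriv F a))) < 0 := by
      rw [hαt, Complex.inner, show -((F a - g a) / ((1 - t) * deriv g a + t * deriv F a)) *
        (starRingEnd ℂ) a = ((-(Complex.normSq a) : ℝ) : ℂ) *
          ((F a - g a) / (a * ((1 - t) * deriv g a + t * deriv F a))) by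
        rw [Complex.ofReal_neg, ← Complex.mul_conj a]; field_simp, Complex.re_ofReal_mul]
      nlinarith [mul_pos (Complex.normSq_pos.2 ha) (hpos ha)]
    filter_upwards [eventually_lt_of_hasDerivAt_neg hα.norm_sq hneg, hroot] with τ hτ hτr
    rw [hαt] at hτ
    exact ⟨(pow_lt_pow_iff_left₀ (norm_nonneg _) (norm_nonneg _) two_ne_zero).1 hτ |>.le, hτr⟩

/-- The times in `[0, 1]` at which the chain takes the value `c` at two distinct points of `K`. -/
def collisionTimes (g F : ℂ → ℂ) (c : ℂ) (K : Set ℂ) : Set ℝ :=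
  {t ∈ Icc (0 : ℝ) 1 | ∃ a ∈ K, ∃ b ∈ K, a ≠ b ∧ chain g F t a = c ∧ chain g F t b = c}

theorem continuousOn_chain {X : Type*} [TopologicalSpace X] {τ : X → ℝ} {p : X → ℂ} {S : Set X}
    (hg : ContinuousOn g K) (hF : ContinuousOn F K) (hτ : ContinuousOn τ S)
    (hp : ContinuousOn p S) (hpK : MapsTo p S K) :
    ContinuousOn (fun x => chain g F (τ x) (p x)) S := by
  have hcast : ContinuousOn (fun x => (τ x : ℂ)) S := Complex.continuous_ofReal.comp_continuousOn hτ
  exact ((continuousOn_const.sub hcast).mul (hg.comp hp hpK)).add (hcast.mul (hF.comp hp hpK))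

theorem eventually_eq_of_chain_eq (hg : AnalyticAt ℂ g a) (hF : AnalyticAt ℂ F a) {t : ℝ}
    (hne : (1 - t) * deriv g a + t * deriv F a ≠ 0) :
    ∀ᶠ v : ℝ × ℂ × ℂ in 𝓝 (t, a, a), chain g F v.1 v.2.1 = chain g F t a →
      chain g F v.1 v.2.2 = chain g F t a → v.2.1 = v.2.2 := by
  obtain ⟨α, -, hiff⟩ := exists_chain_branch hg hF hne
  have hfst : Continuous fun v : ℝ × ℂ × ℂ => (v.1, v.2.1) := by fun_prop
  have hsnd : Continuous fun v : ℝ × ℂ × ℂ => (v.1, v.2.2) := by fun_prop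
  filter_upwards [(hfst.tendsto (t, a, a)).eventually hiff,
    (hsnd.tendsto (t, a, a)).eventually hiff] with v hv hv' hva hvb
  exact (hv.1 hva).symm.trans (hv'.1 hvb)

theorem isClosed_collisionTimes (hK : IsCompact K) (hg : ∀ a ∈ K, AnalyticAt ℂ g a)
    (hF : ∀ a ∈ K, AnalyticAt ℂ F a)
    (hne : ∀ t ∈ Icc (0 : ℝ) 1, ∀ a ∈ K, (1 - t) * deriv g a + t * deriv F a ≠ 0) :
    IsClosed (collisionTimes g F c K) := by
  have hgK : ContinuousOn g K := fun a ha => (hg a ha).continuousAt.continuousWithinAt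
  have hFK : ContinuousOn F K := fun a ha => (hF a ha).continuousAt.continuousWithinAt
  set B : Set (ℝ × ℂ × ℂ) := Icc 0 1 ×ˢ K ×ˢ K
  have hcpt : IsCompact B := isCompact_Icc.prod (hK.prod hK)
  set N : Set (ℝ × ℂ × ℂ) :=
    {v | chain g F v.1 v.2.1 = c → chain g F v.1 v.2.2 = c → v.2.1 = v.2.2}
  have hlevel : IsCompact (B ∩ (fun v : ℝ × ℂ × ℂ =>
      (chain g F v.1 v.2.1, chain g F v.1 v.2.2)) ⁻¹' {(c, c)}) := by
    refine hcpt.of_isClosed_subset (ContinuousOn.preimage_isClosed_of_isClosed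
      (ContinuousOn.prodMk ?_ ?_) hcpt.isClosed isClosed_singleton) inter_subset_left
    · exact continuousOn_chain hgK hFK (by fun_prop) (by fun_prop) fun v hv => hv.2.1
    · exact continuousOn_chain hgK hFK (by fun_prop) (by fun_prop) fun v hv => hv.2.2
  convert ((hlevel.diff (isOpen_interior (s := N))).image continuous_fst).isClosed using 1
  ext t
  constructor
  · rintro ⟨ht, a, ha, b, hb, hab, hca, hcb⟩
    exact ⟨(t, a, b), ⟨⟨⟨ht, ha, hb⟩, Prod.ext hca hcb⟩,
      fun hint => hab (interior_subset hint hca hcb)⟩, rfl⟩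
  · rintro ⟨⟨t, a, b⟩, ⟨⟨⟨ht, ha, hb⟩, hc⟩, hint⟩, rfl⟩
    obtain ⟨hca, hcb⟩ : chain g F t a = c ∧ chain g F t b = c := Prod.mk.inj hc
    refine ⟨ht, a, ha, b, hb, ?_, hca, hcb⟩
    rintro rfl
    refine hint (mem_interior_iff_mem_nhds.2 ?_)
    filter_upwards [eventually_eq_of_chain_eq (hg a ha) (hF a ha) (hne t ht a ha)] with v hv
    rwa [hca] at hv

theorem UnivalentOn.of_chain (hF : UnivalentOn F disk) (hg : DifferentiableOn ℂ g disk)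
    (h0 : g 0 = F 0)
    (hne : ∀ t ∈ Icc (0 : ℝ) 1, ∀ z ∈ disk, (1 - t) * deriv g z + t * deriv F z ≠ 0)
    (hpos : ∀ t ∈ Icc (0 : ℝ) 1, ∀ z ∈ disk, z ≠ 0 →
      0 < ((F z - g z) / (z * ((1 - t) * deriv g z + t * deriv F z))).re) :
    UnivalentOn g disk := by
  refine ⟨isOpen_ball, hg, fun z₁ hz₁ z₂ hz₂ heq => ?_⟩
  by_contra hz
  have hsub : closedBall (0 : ℂ) (max ‖z₁‖ ‖z₂‖) ⊆ disk :=
    closedBall_subset_ball (max_lt (mem_disk.1 hz₁) (mem_disk.1 hz₂))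
  set K := closedBall (0 : ℂ) (max ‖z₁‖ ‖z₂‖) with hK
  have hgK (a : ℂ) (ha : a ∈ K) := analyticAt_of_mem_disk hg (hsub ha)
  have hFK (a : ℂ) (ha : a ∈ K) := analyticAt_of_mem_disk hF.analytic (hsub ha)
  have hclosed : IsClosed (collisionTimes g F (g z₁) K ∩ Icc 0 1) :=
    (isClosed_collisionTimes (isCompact_closedBall _ _) hgK hFK
      fun t ht a ha => hne t ht a (hsub ha)).inter isClosed_Icc
  have hstart : (0 : ℝ) ∈ collisionTimes g F (g z₁) K :=
    ⟨left_mem_Icc.2 zero_le_one, z₁, mem_closedBall_zero_iff.2 (le_max_left _ _), z₂,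
      mem_closedBall_zero_iff.2 (le_max_right _ _), hz, by simp [chain], by simp [chain, heq]⟩
  obtain ⟨-, a, ha, b, hb, hab, hca, hcb⟩ := hclosed.Icc_subset_of_forall_mem_nhdsWithin hstart (by
    rintro t ⟨⟨-, a, ha, b, hb, hab, hca, hcb⟩, ht⟩
    have htI := Ico_subset_Icc_self ht
    obtain ⟨α, hαc, hαt, hα⟩ := exists_chain_branch_norm_le (hgK a ha) (hFK a ha) h0
      (hne t htI a (hsub ha)) (hpos t htI a (hsub ha))
    obtain ⟨β, hβc, hβt, hβ⟩ := exists_chain_branch_norm_le (hgK b hb) (hFK b hb) h0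
      (hne t htI b (hsub hb)) (hpos t htI b (hsub hb))
    have hαβ : ∀ᶠ τ in 𝓝 t, α τ - β τ ≠ 0 :=
      (hαc.sub hβc).eventually_ne (by rw [Pi.sub_apply, hαt, hβt]; exact sub_ne_zero.2 hab)
    filter_upwards [hα, hβ, nhdsWithin_le_nhds hαβ, Ioc_mem_nhdsGT ht.2] with τ hατ hβτ hne hτ
    rw [hK, mem_closedBall_zero_iff] at ha hb
    exact ⟨⟨ht.1.trans hτ.1.le, hτ.2⟩, α τ, mem_closedBall_zero_iff.2 (hατ.1.trans ha), β τ,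
      mem_closedBall_zero_iff.2 (hβτ.1.trans hb), sub_ne_zero.1 hne, hατ.2.trans hca,
      hβτ.2.trans hcb⟩) (right_mem_Icc.2 zero_le_one)
  simp only [chain, Complex.ofReal_one, sub_self, zero_mul, one_mul, zero_add] at hca hcb
  exact hab (hF.injOn (hsub ha) (hsub hb) (hca.trans hcb.symm))

/-! ### The Briot–Bouquet equation -/

theorem re_inv_pos (hz : 0 < z.re) : 0 < (z⁻¹).re := by
  rw [Complex.inv_re]
  exact div_pos hz (Complex.normSq_pos.2 (Complex.ne_zero_of_re_pos hz))

namespace BriotBouquetSolution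

theorem map_zero (hψ : BriotBouquetSolution φ ψ) : ψ 0 = φ 0 := by
  simpa using hψ.equation 0 zero_mem_disk

theorem mul_deriv (hψ : BriotBouquetSolution φ ψ) (hz : z ∈ disk) :
    z * deriv ψ z = ψ z * (φ z - ψ z) := by
  rw [← hψ.equation z hz, add_sub_cancel_left, mul_div_cancel₀ _ (hψ.ne_zero z hz)]

theorem one_add_mul_deriv_zero (hψ : BriotBouquetSolution φ ψ) (hφ : DifferentiableAt ℂ φ 0) :
    (1 + φ 0) * deriv ψ 0 = φ 0 * deriv φ 0 := by
  have hdψ := (differentiableAt_of_mem_disk hψ.analytic zero_mem_disk).hasDerivAt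
  have hddψ := (differentiableAt_of_mem_disk (hψ.analytic.deriv isOpen_ball)
    zero_mem_disk).hasDerivAt
  have hlhs := (hasDerivAt_id (0 : ℂ)).fun_mul hddψ
  have hrhs := hdψ.fun_mul (hφ.hasDerivAt.fun_sub hdψ)
  have heq := hlhs.unique (hrhs.congr_of_eventuallyEq (by
    filter_upwards [disk_mem_nhds zero_mem_disk] with z hz using hψ.mul_deriv hz))
  rw [hψ.map_zero] at heq
  simp only [id] at heq
  linear_combination heq

theorem mul_deriv_ne (hψ : BriotBouquetSolution φ ψ) (hφ : UnivalentOn φ disk)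
    (hconv : Convex ℝ (φ '' disk)) (hre : ∀ z ∈ disk, 0 < (φ z).re) (hz : z ∈ disk)
    (hζ : ζ ∈ disk) (hζ0 : ζ ≠ 0) (hle : ‖z‖ ≤ ‖ζ‖) {k : ℝ} (hk : 0 < k) (heq : ψ z = φ ζ) :
    z * deriv ψ z ≠ k * (ζ * deriv φ ζ) := fun hderiv => by
  have hquot : (φ z - φ ζ) / (ζ * deriv φ ζ) = (k : ℂ) * (φ ζ)⁻¹ := by
    have hφζ : φ ζ ≠ 0 := Complex.ne_zero_of_re_pos (hre ζ hζ)
    rw [div_eq_iff (mul_ne_zero hζ0 (hφ.deriv_ne_zero hζ))]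
    field_simp
    rw [← heq]
    linear_combination hderiv - hψ.mul_deriv hz
  have hnonpos := hφ.re_sub_div_nonpos_of_convex hconv hζ hζ0 hle
  rw [hquot, Complex.re_ofReal_mul] at hnonpos
  exact (mul_pos hk (re_inv_pos (hre ζ hζ))).not_ge hnonpos

theorem subordinate (hψ : BriotBouquetSolution φ ψ) (hφ : UnivalentOn φ disk)
    (hconv : Convex ℝ (φ '' disk)) (hre : ∀ z ∈ disk, 0 < (φ z).re) : Subordinate ψ φ :=
  hφ.subordinate_of_mul_deriv_ne hψ.analytic hψ.map_zero fun _ hz _ hζ _ hlt hk heq =>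
    hψ.mul_deriv_ne hφ hconv hre hz hζ (norm_pos_iff.1 ((norm_nonneg _).trans_lt hlt)) hlt.le
      (zero_lt_one.trans_le hk) heq

theorem exists_norm_lt_and_eq (hψ : BriotBouquetSolution φ ψ) (hφ : UnivalentOn φ disk)
    (hconv : Convex ℝ (φ '' disk)) (hre : ∀ z ∈ disk, 0 < (φ z).re) (hz : z ∈ disk)
    (hz0 : z ≠ 0) : ∃ w, ‖w‖ < ‖z‖ ∧ ψ z = φ w := by
  obtain ⟨ω, hω, heq⟩ := subordinate_iff.1 (hψ.subordinate hφ hconv hre)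
  refine ⟨ω z, (hω.norm_le hz).lt_of_ne fun hnorm => ?_, heq hz⟩
  have hωz0 : ω z ≠ 0 := norm_ne_zero_iff.1 (hnorm ▸ norm_ne_zero_iff.2 hz0)
  have hωz : DifferentiableAt ℂ ω z := differentiableAt_of_mem_disk hω.analytic hz
  obtain ⟨k, hk, hkeq⟩ := exists_one_le_mul_deriv_eq
    (hω.analytic.mono (ball_subset_ball (mem_disk.1 hz).le)) hωz hω.map_zero hz0 hωz0
    fun y hy => (hω.norm_le (mem_disk.2 (hy.trans_lt (mem_disk.1 hz)))).trans (hy.trans hnorm.ge)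
  refine hψ.mul_deriv_ne hφ hconv hre hz (hω.mapsTo hz) hωz0 hnorm.ge
    (zero_lt_one.trans_le hk) (heq hz) ?_
  have hderiv : HasDerivAt ψ (deriv φ (ω z) * deriv ω z) z :=
    ((differentiableAt_of_mem_disk hφ.analytic (hω.mapsTo hz)).hasDerivAt.comp z
      hωz.hasDerivAt).congr_of_eventuallyEq (heq.eventuallyEq_of_mem (disk_mem_nhds hz))
  rw [hderiv.deriv]
  linear_combination deriv φ (ω z) * hkeq

theorem re_pos (hψ : BriotBouquetSolution φ ψ) (hφ : UnivalentOn φ disk)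
    (hconv : Convex ℝ (φ '' disk)) (hre : ∀ z ∈ disk, 0 < (φ z).re) (hz : z ∈ disk) :
    0 < (ψ z).re := by
  obtain ⟨w, -, -, hw, heq⟩ := hψ.subordinate hφ hconv hre
  exact heq z hz ▸ hre _ (hw z hz)

theorem re_sub_div_pos (hψ : BriotBouquetSolution φ ψ) (hφ : UnivalentOn φ disk)
    (hconv : Convex ℝ (φ '' disk)) (hre : ∀ z ∈ disk, 0 < (φ z).re) (hz : z ∈ disk)
    (hz0 : z ≠ 0) : 0 < ((φ z - ψ z) / (z * deriv φ z)).re := by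
  obtain ⟨w, hw, heq⟩ := hψ.exists_norm_lt_and_eq hφ hconv hre hz hz0
  rw [heq, ← neg_sub, neg_div, Complex.neg_re]
  exact neg_pos.2 (hφ.re_sub_div_neg_of_convex hconv hz hw)

theorem re_chain_pos (hψ : BriotBouquetSolution φ ψ) (hφ : UnivalentOn φ disk)
    (hconv : Convex ℝ (φ '' disk)) (hre : ∀ z ∈ disk, 0 < (φ z).re) (hz : z ∈ disk)
    (hz0 : z ≠ 0) {t : ℝ} (ht : t ∈ Icc (0 : ℝ) 1) :
    0 < ((φ z - ψ z) / (z * ((1 - t) * deriv ψ z + t * deriv φ z))).re := by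
  set Q := (φ z - ψ z) / (z * deriv φ z) with hQ
  have hQpos : 0 < Q.re := hψ.re_sub_div_pos hφ hconv hre hz hz0
  have hsub : φ z - ψ z ≠ 0 := (div_ne_zero_iff.1 (Complex.ne_zero_of_re_pos hQpos)).1
  -- By the equation, `z * ψ' / (φ - ψ) = ψ`: both extreme quotients have positive real part.
  have hinv : (φ z - ψ z) / (z * ((1 - t) * deriv ψ z + t * deriv φ z)) =
      ((1 - t : ℝ) * ψ z + (t : ℝ) * Q⁻¹)⁻¹ := by
    rw [hQ, inv_div, ← inv_div, inv_inj, div_eq_iff hsub, add_mul, mul_assoc, mul_assoc,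
      div_mul_cancel₀ _ hsub, ← hψ.mul_deriv hz]
    push_cast
    ring
  have hmem := convex_halfSpace_re_gt 0 (hψ.re_pos hφ hconv hre hz) (re_inv_pos hQpos)
    (sub_nonneg.2 ht.2) ht.1 (sub_add_cancel 1 t)
  rw [hinv]
  simpa only [Complex.real_smul] using re_inv_pos hmem

theorem chain_deriv_ne_zero (hψ : BriotBouquetSolution φ ψ) (hφ : UnivalentOn φ disk)
    (hconv : Convex ℝ (φ '' disk)) (hre : ∀ z ∈ disk, 0 < (φ z).re) (hz : z ∈ disk) {t : ℝ}
    (ht : t ∈ Icc (0 : ℝ) 1) : (1 - t) * deriv ψ z + t * deriv φ z ≠ 0 := fun hzero => by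
  rcases eq_or_ne z 0 with rfl | hz0
  · have hnum : φ 0 + t ≠ 0 := Complex.ne_zero_of_re_pos (by
      simpa using add_pos_of_pos_of_nonneg (hre 0 hz) ht.1)
    have hprod : (φ 0 + t) * deriv φ 0 = 0 := by
      linear_combination (1 + φ 0) * hzero - (1 - t) *
        hψ.one_add_mul_deriv_zero (differentiableAt_of_mem_disk hφ.analytic hz)
    exact mul_ne_zero hnum (hφ.deriv_ne_zero hz) hprod
  · have hpos := hψ.re_chain_pos hφ hconv hre hz hz0 ht
    rw [hzero, mul_zero, div_zero, Complex.zero_re] at hpos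
    exact hpos.false

theorem univalentOn (hψ : BriotBouquetSolution φ ψ) (hφ : UnivalentOn φ disk)
    (hconv : Convex ℝ (φ '' disk)) (hre : ∀ z ∈ disk, 0 < (φ z).re) : UnivalentOn ψ disk :=
  hφ.of_chain hψ.analytic hψ.map_zero
    (fun _ ht _ hz => hψ.chain_deriv_ne_zero hφ hconv hre hz ht)
    fun _ ht _ hz hz0 => hψ.re_chain_pos hφ hconv hre hz hz0 ht

end BriotBouquetSolution

/-! ### The Briot–Bouquet subordination for the convex class -/

theorem UnivalentOn.inv (hF : UnivalentOn F U) (hne : ∀ z ∈ U, F z ≠ 0) :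
    UnivalentOn (fun z => (F z)⁻¹) U :=
  ⟨hF.isOpen, hF.analytic.fun_inv hne, fun _ hz _ hw h => hF.injOn hz hw (inv_injective h)⟩

theorem eq_mul_dslope_zero (h0 : f 0 = 0) (z : ℂ) : f z = z * dslope f 0 z := by
  simpa only [sub_zero, smul_eq_mul] using (sub_smul_dslope_of_zero h0 z).symm

theorem differentiableOn_dslope_zero (hf : DifferentiableOn ℂ f disk) :
    DifferentiableOn ℂ (dslope f 0) disk :=
  (Complex.differentiableOn_dslope (disk_mem_nhds zero_mem_disk)).2 hf

theorem dslope_div_deriv_mul (hf : DifferentiableOn ℂ f disk) (h0 : f 0 = 0) (hz : z ∈ disk)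
    (hz' : deriv f z ≠ 0) :
    dslope f 0 z / deriv f z * (1 + z * deriv (deriv f) z / deriv f z) =
      1 - z * deriv (fun x => dslope f 0 x / deriv f x) z := by
  have hf' := (differentiableAt_of_mem_disk hf hz).hasDerivAt
  have hf'' := (differentiableAt_of_mem_disk (hf.deriv isOpen_ball) hz).hasDerivAt
  have hd := (differentiableAt_of_mem_disk (differentiableOn_dslope_zero hf) hz).hasDerivAt
  have heq := hf'.unique (((hasDerivAt_id z).fun_mul hd).congr_of_eventuallyEq
    (.of_forall (eq_mul_dslope_zero h0)))
  simp only [id, one_mul] at heq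
  rw [(hd.fun_div hf'' hz').deriv]
  field_simp
  linear_combination -deriv f z * heq

theorem ConvexClass.map_zero (hf : ConvexClass φ f) : φ 0 = 1 := by
  obtain ⟨w, -, hw0, -, hw⟩ := hf.subordinate
  simpa [hw0] using (hw 0 zero_mem_disk).symm

namespace BriotBouquetSolution

theorem mul_deriv_inv (hψ : BriotBouquetSolution φ ψ) (hz : z ∈ disk) :
    z * deriv (fun x => (ψ x)⁻¹) z = 1 - φ z * (ψ z)⁻¹ := by
  have hne := hψ.ne_zero z hz
  rw [((differentiableAt_of_mem_disk hψ.analytic hz).hasDerivAt.fun_inv hne).deriv]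
  field_simp
  linear_combination -hψ.mul_deriv hz

theorem subordinate_dslope_div_deriv (hψ : BriotBouquetSolution φ ψ) (hφ : UnivalentOn φ disk)
    (hconv : Convex ℝ (φ '' disk)) (hre : ∀ z ∈ disk, 0 < (φ z).re) (hf : ConvexClass φ f) :
    Subordinate (fun z => dslope f 0 z / deriv f z) fun z => (ψ z)⁻¹ := by
  have han := hf.normalized.analytic
  obtain ⟨w, hw, hweq⟩ := subordinate_iff.1 hf.subordinate
  refine ((hψ.univalentOn hφ hconv hre).inv hψ.ne_zero).subordinate_of_mul_deriv_ne
    ((differentiableOn_dslope_zero han).fun_div (han.deriv isOpen_ball) hf.deriv_ne_zero)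
    (by rw [dslope_same, hf.normalized.deriv_zero, hψ.map_zero, hf.map_zero, div_one, inv_one])
    fun z hz ζ hζ k hlt hk heq hderiv => ?_
  have hode := dslope_div_deriv_mul han hf.normalized.map_zero hz (hf.deriv_ne_zero z hz)
  have hφw : 1 + z * deriv (deriv f) z / deriv f z = φ (w z) := hweq hz
  rw [hφw, hderiv, heq, hψ.mul_deriv_inv hζ] at hode
  -- `φ (w z)` lies beyond `φ ζ` in the outward direction `φ ζ - ψ ζ`, although `‖w z‖ < ‖ζ‖`.
  have hout : φ (w z) - φ ζ = ((k - 1 : ℝ) : ℂ) * (φ ζ - ψ ζ) := by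
    have hne := hψ.ne_zero ζ hζ
    field_simp at hode
    push_cast
    linear_combination hode
  have hneg := hφ.re_sub_div_neg_of_convex hconv hζ ((hw.norm_le hz).trans_lt hlt)
  rw [hout, mul_div_assoc, Complex.re_ofReal_mul] at hneg
  exact hneg.not_ge (mul_nonneg (sub_nonneg.2 hk) (hψ.re_sub_div_pos hφ hconv hre hζ
    (norm_pos_iff.1 ((norm_nonneg z).trans_lt hlt))).le)

theorem subordinate_deriv_div_dslope (hψ : BriotBouquetSolution φ ψ) (hφ : UnivalentOn φ disk)
    (hconv : Convex ℝ (φ '' disk)) (hre : ∀ z ∈ disk, 0 < (φ z).re) (hf : ConvexClass φ f) :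
    Subordinate (fun z => deriv f z / dslope f 0 z) ψ := by
  obtain ⟨ω, hω, heq⟩ := subordinate_iff.1 (hψ.subordinate_dslope_div_deriv hφ hconv hre hf)
  refine subordinate_iff.2 ⟨ω, hω, fun z hz => ?_⟩
  simpa using congr_arg (·⁻¹) (heq hz)

end BriotBouquetSolution

/-! ### Taylor coefficients -/

theorem taylorCoeff_zero (g : ℂ → ℂ) : taylorCoeff g 0 = g 0 := by simp [taylorCoeff]

theorem taylorCoeff_one (g : ℂ → ℂ) : taylorCoeff g 1 = deriv g 0 := by
  simp [taylorCoeff, iteratedDeriv_one]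

theorem taylorCoeff_congr (hgh : g =ᶠ[𝓝 0] h) (n : ℕ) : taylorCoeff g n = taylorCoeff h n := by
  rw [taylorCoeff, taylorCoeff, hgh.iteratedDeriv_eq]

theorem taylorCoeff_const_mul (c : ℂ) (g : ℂ → ℂ) (n : ℕ) :
    taylorCoeff (fun z => c * g z) n = c * taylorCoeff g n := by
  rw [taylorCoeff, iteratedDeriv_const_mul_field, taylorCoeff, mul_div_assoc]

theorem taylorCoeff_const_add_succ (c : ℂ) (g : ℂ → ℂ) (n : ℕ) :
    taylorCoeff (fun z => c + g z) (n + 1) = taylorCoeff g (n + 1) := by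
  rw [taylorCoeff, iteratedDeriv_const_add n.succ_pos, taylorCoeff]

theorem taylorCoeff_sum {ι : Type*} {s : Finset ι} {G : ι → ℂ → ℂ}
    (hG : ∀ i ∈ s, AnalyticAt ℂ (G i) 0) (n : ℕ) :
    taylorCoeff (fun z => ∑ i ∈ s, G i z) n = ∑ i ∈ s, taylorCoeff (G i) n := by
  simp only [taylorCoeff, iteratedDeriv_fun_sum fun i hi => (hG i hi).contDiffAt, Finset.sum_div]

theorem taylorCoeff_mul (hg : AnalyticAt ℂ g 0) (hh : AnalyticAt ℂ h 0) (n : ℕ) :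
    taylorCoeff (fun z => g z * h z) n =
      ∑ i ∈ Finset.range (n + 1), taylorCoeff g i * taylorCoeff h (n - i) := by
  rw [taylorCoeff, iteratedDeriv_fun_mul hg.contDiffAt hh.contDiffAt, Finset.sum_div]
  refine Finset.sum_congr rfl fun i hi => ?_
  have hfact (k : ℕ) : (k.factorial : ℂ) ≠ 0 := Nat.cast_ne_zero.2 k.factorial_ne_zero
  rw [Nat.cast_choose ℂ (Nat.lt_succ_iff.1 (Finset.mem_range.1 hi)), taylorCoeff, taylorCoeff]
  field_simp [hfact n, hfact i, hfact (n - i)]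

theorem taylorCoeff_deriv (g : ℂ → ℂ) (n : ℕ) :
    taylorCoeff (deriv g) n = (n + 1) * taylorCoeff g (n + 1) := by
  rw [taylorCoeff, taylorCoeff, iteratedDeriv_succ', Nat.factorial_succ]
  have hfact : (n.factorial : ℂ) ≠ 0 := Nat.cast_ne_zero.2 n.factorial_ne_zero
  have hsucc : (n : ℂ) + 1 ≠ 0 := Nat.cast_add_one_ne_zero n
  push_cast
  field_simp

theorem taylorCoeff_pow (m n : ℕ) : taylorCoeff (fun z => z ^ m) n = if n = m then 1 else 0 := by
  rw [taylorCoeff, iteratedDeriv_fun_pow_zero]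
  split_ifs with hnm
  · rw [hnm, div_self (Nat.cast_ne_zero.2 m.factorial_ne_zero)]
  · simp

theorem taylorCoeff_id_mul_succ (hg : AnalyticAt ℂ g 0) (n : ℕ) :
    taylorCoeff (fun z => z * g z) (n + 1) = taylorCoeff g n := by
  have hpow (i : ℕ) : taylorCoeff (fun z => z) i = if i = 1 then 1 else 0 := by
    simpa only [pow_one] using taylorCoeff_pow 1 i
  simp [taylorCoeff_mul (g := fun z => z) (by fun_prop) hg, hpow]

theorem eq_add_mul_dslope (g : ℂ → ℂ) (z : ℂ) : g z = g 0 + z * dslope g 0 z := by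
  have hsub := sub_smul_dslope g 0 z
  rw [sub_zero, smul_eq_mul] at hsub
  rw [hsub, add_sub_cancel]

theorem analyticAt_dslope_zero (hg : AnalyticAt ℂ g 0) : AnalyticAt ℂ (dslope g 0) 0 :=
  let ⟨_, hp⟩ := hg
  hp.has_fpower_series_dslope_fslope.analyticAt

theorem taylorCoeff_dslope (hg : AnalyticAt ℂ g 0) (n : ℕ) :
    taylorCoeff (dslope g 0) n = taylorCoeff g (n + 1) := by
  rw [taylorCoeff_congr (.of_forall (eq_add_mul_dslope g)), taylorCoeff_const_add_succ,
    taylorCoeff_id_mul_succ (analyticAt_dslope_zero hg)]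

theorem taylorCoeff_comp_mul (hg : AnalyticAt ℂ g 0) (c : ℂ) (n : ℕ) :
    taylorCoeff (fun z => g (c * z)) n = c ^ n * taylorCoeff g n := by
  induction n generalizing g with
  | zero => simp [taylorCoeff_zero]
  | succ n ih =>
    have hd := analyticAt_dslope_zero hg
    have hcomp : AnalyticAt ℂ (fun z => c * dslope g 0 (c * z)) 0 :=
      analyticAt_const.mul (AnalyticAt.fun_comp (by simpa using hd) (by fun_prop))
    have hsplit : (fun z => g (c * z)) = fun z => g 0 + z * (c * dslope g 0 (c * z)) := by
      ext z
      rw [eq_add_mul_dslope g (c * z)]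
      ring
    rw [hsplit, taylorCoeff_const_add_succ, taylorCoeff_id_mul_succ hcomp, taylorCoeff_const_mul,
      ih hd, taylorCoeff_dslope hg]
    ring

/-! ### Square sums of Taylor coefficients -/

theorem circleIntegrable_of_continuousOn_disk {E : Type*} [NormedAddCommGroup E] {u : ℂ → E}
    (hu : ContinuousOn u disk) (hr : 0 < r) (hr1 : r < 1) : CircleIntegrable u 0 r :=
  (hu.mono (sphere_subset_closedBall.trans (closedBall_subset_ball hr1))).circleIntegrable hr.le

theorem circleAverage_eq_apply_zero (hh : DifferentiableOn ℂ h disk) (hr : 0 < r) (hr1 : r < 1) :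
    Real.circleAverage h 0 r = h 0 := by
  have hsub : closedBall 0 |r| ⊆ disk := closedBall_subset_ball (by rwa [abs_of_pos hr])
  exact circleAverage_of_differentiable_on_off_countable countable_empty
    (hh.continuousOn.mono hsub)
    fun z hz => differentiableAt_of_mem_disk hh (hsub (ball_subset_closedBall hz.1))

theorem circleAverage_conj_pow_succ (n : ℕ) (hr : 0 < r) (hr1 : r < 1) :
    Real.circleAverage (fun z => (starRingEnd ℂ) z ^ (n + 1)) 0 r = 0 := by
  have hpow : DifferentiableOn ℂ (fun z : ℂ => z ^ (n + 1)) disk := by fun_prop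
  have hconj := ContinuousLinearMap.circleAverage_comp_comm (Complex.conjCLE : ℂ →L[ℝ] ℂ)
    (circleIntegrable_of_continuousOn_disk hpow.continuousOn hr hr1)
  rw [circleAverage_eq_apply_zero hpow hr hr1] at hconj
  simpa [Function.comp_def] using hconj

theorem circleAverage_mul_conj_pow (hh : DifferentiableOn ℂ h disk) (n : ℕ) (hr : 0 < r)
    (hr1 : r < 1) :
    Real.circleAverage (fun z => h z * (starRingEnd ℂ) z ^ n) 0 r =
      r ^ (2 * n) * taylorCoeff h n := by
  induction n generalizing h with
  | zero => simp [taylorCoeff_zero, circleAverage_eq_apply_zero hh hr hr1]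
  | succ n ih =>
    have hd := differentiableOn_dslope_zero hh
    have hsplit : EqOn (fun z => h z * (starRingEnd ℂ) z ^ (n + 1)) (fun z =>
        h 0 • (starRingEnd ℂ) z ^ (n + 1) + (r ^ 2 : ℂ) • (dslope h 0 z * (starRingEnd ℂ) z ^ n))
        (sphere 0 |r|) := by
      intro z hz
      have hmul_conj : z * (starRingEnd ℂ) z = r ^ 2 := by
        rw [Complex.mul_conj', mem_sphere_zero_iff_norm.1 hz, abs_of_pos hr]
      simp only [smul_eq_mul]
      rw [← hmul_conj, eq_add_mul_dslope h z]
      ring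
    have hint₀ : CircleIntegrable (fun z => h 0 • (starRingEnd ℂ) z ^ (n + 1)) 0 r :=
      circleIntegrable_of_continuousOn_disk (by fun_prop) hr hr1
    have hint₁ : CircleIntegrable
        (fun z => (r ^ 2 : ℂ) • (dslope h 0 z * (starRingEnd ℂ) z ^ n)) 0 r :=
      (circleIntegrable_of_continuousOn_disk (hd.continuousOn.mul (by fun_prop)) hr hr1).const_smul
    rw [Real.circleAverage_congr_sphere hsplit, Real.circleAverage_fun_add hint₀ hint₁,
      Real.circleAverage_fun_smul, Real.circleAverage_fun_smul,
      circleAverage_conj_pow_succ n hr hr1, ih hd,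
      taylorCoeff_dslope (analyticAt_of_mem_disk hh zero_mem_disk)]
    simp only [smul_eq_mul]
    ring

/-- The partial sum of degree `< n` of the Taylor series at the origin. -/
noncomputable def taylorSum (n : ℕ) (g : ℂ → ℂ) (z : ℂ) : ℂ :=
  ∑ m ∈ Finset.range n, taylorCoeff g m * z ^ m

theorem differentiable_taylorSum (n : ℕ) (g : ℂ → ℂ) : Differentiable ℂ (taylorSum n g) := by
  unfold taylorSum
  fun_prop

theorem taylorCoeff_taylorSum (hm : m < n) (g : ℂ → ℂ) :
    taylorCoeff (taylorSum n g) m = taylorCoeff g m := by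
  unfold taylorSum
  rw [taylorCoeff_sum fun i _ => by fun_prop]
  simp [taylorCoeff_const_mul, taylorCoeff_pow, hm]

theorem taylorSum_taylorSum (n : ℕ) (g : ℂ → ℂ) : taylorSum n (taylorSum n g) = taylorSum n g :=
  funext fun _ => Finset.sum_congr rfl fun _ hm => by
    rw [taylorCoeff_taylorSum (Finset.mem_range.1 hm)]

theorem circleAverage_re_mul_conj_taylorSum (hh : DifferentiableOn ℂ h disk) (n : ℕ)
    (hr : 0 < r) (hr1 : r < 1) :
    Real.circleAverage (fun z => (h z * (starRingEnd ℂ) (taylorSum n h z)).re) 0 r =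
      ∑ m ∈ Finset.range n, r ^ (2 * m) * ‖taylorCoeff h m‖ ^ 2 := by
  have hexpand : (fun z => (h z * (starRingEnd ℂ) (taylorSum n h z)).re) = Complex.reCLM ∘ fun z =>
      ∑ m ∈ Finset.range n,
        (starRingEnd ℂ) (taylorCoeff h m) • (h z * (starRingEnd ℂ) z ^ m) := by
    ext z
    simp only [taylorSum, map_sum, map_mul, map_pow, Finset.mul_sum, smul_eq_mul,
      Function.comp_apply, Complex.reCLM_apply, Complex.re_sum, mul_left_comm (h z)]
  have hint (m : ℕ) : CircleIntegrable
      (fun z => (starRingEnd ℂ) (taylorCoeff h m) • (h z * (starRingEnd ℂ) z ^ m)) 0 r :=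
    (circleIntegrable_of_continuousOn_disk (hh.continuousOn.mul (by fun_prop)) hr hr1).const_smul
  rw [hexpand, ContinuousLinearMap.circleAverage_comp_comm _ (.fun_sum _ fun m _ => hint m),
    Real.circleAverage_fun_sum fun m _ => hint m, map_sum]
  refine Finset.sum_congr rfl fun m _ => ?_
  rw [Real.circleAverage_fun_smul, circleAverage_mul_conj_pow hh m hr hr1, smul_eq_mul,
    mul_left_comm, Complex.conj_mul', Complex.reCLM_apply]
  norm_cast

theorem circleAverage_norm_sq_taylorSum (g : ℂ → ℂ) (n : ℕ) (hr : 0 < r) (hr1 : r < 1) :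
    Real.circleAverage (fun z => ‖taylorSum n g z‖ ^ 2) 0 r =
      ∑ m ∈ Finset.range n, r ^ (2 * m) * ‖taylorCoeff g m‖ ^ 2 := by
  have hself := circleAverage_re_mul_conj_taylorSum
    (differentiable_taylorSum n g).differentiableOn n hr hr1
  simp only [taylorSum_taylorSum, Complex.mul_conj'] at hself
  norm_cast at hself
  rw [hself]
  exact Finset.sum_congr rfl fun m hm => by rw [taylorCoeff_taylorSum (Finset.mem_range.1 hm)]

theorem sum_norm_taylorCoeff_sq_le_circleAverage (hh : DifferentiableOn ℂ h disk) (n : ℕ)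
    (hr : 0 < r) (hr1 : r < 1) :
    ∑ m ∈ Finset.range n, r ^ (2 * m) * ‖taylorCoeff h m‖ ^ 2 ≤
      Real.circleAverage (fun z => ‖h z‖ ^ 2) 0 r := by
  have hT := (differentiable_taylorSum n h).continuous.continuousOn (s := disk)
  have hre : CircleIntegrable (fun z => (h z * (starRingEnd ℂ) (taylorSum n h z)).re) 0 r :=
    circleIntegrable_of_continuousOn_disk (Complex.continuous_re.comp_continuousOn
      (hh.continuousOn.mul (Complex.continuous_conj.comp_continuousOn hT))) hr hr1
  have hsq {k : ℂ → ℂ} (hk : ContinuousOn k disk) : CircleIntegrable (fun z => ‖k z‖ ^ 2) 0 r :=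
    circleIntegrable_of_continuousOn_disk (hk.norm.pow 2) hr hr1
  have hmono : Real.circleAverage (fun z => (2 : ℝ) • (h z * (starRingEnd ℂ) (taylorSum n h z)).re)
      0 r ≤
      Real.circleAverage (fun z => ‖h z‖ ^ 2 + ‖taylorSum n h z‖ ^ 2) 0 r := by
    refine Real.circleAverage_mono hre.const_smul ((hsq hh.continuousOn).add (hsq hT)) fun z _ => ?_
    have hle := Complex.re_le_norm (h z * (starRingEnd ℂ) (taylorSum n h z))
    rw [norm_mul, RCLike.norm_conj] at hle
    simp only [smul_eq_mul]
    linarith [two_mul_le_add_sq ‖h z‖ ‖taylorSum n h z‖]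
  rw [Real.circleAverage_fun_smul, circleAverage_re_mul_conj_taylorSum hh n hr hr1,
    Real.circleAverage_fun_add (hsq hh.continuousOn) (hsq hT),
    circleAverage_norm_sq_taylorSum h n hr hr1, smul_eq_mul] at hmono
  linarith

/-- The sum of the squared moduli of the first `n` Taylor coefficients at the origin. -/
noncomputable def sqSum (n : ℕ) (g : ℂ → ℂ) : ℝ := ∑ m ∈ Finset.range n, ‖taylorCoeff g m‖ ^ 2

theorem sqSum_congr (hgh : g =ᶠ[𝓝 0] h) (n : ℕ) : sqSum n g = sqSum n h := by
  simp only [sqSum, taylorCoeff_congr hgh]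

theorem sqSum_succ_const_add_id_mul (c : ℂ) (hg : AnalyticAt ℂ g 0) (n : ℕ) :
    sqSum (n + 1) (fun z => c + z * g z) = sqSum n g + ‖c‖ ^ 2 := by
  simp [sqSum, Finset.sum_range_succ', taylorCoeff_zero, taylorCoeff_const_add_succ,
    taylorCoeff_id_mul_succ hg]

theorem norm_taylorCoeff_sq_le_sqSum (hmn : m < n) (g : ℂ → ℂ) :
    ‖taylorCoeff g m‖ ^ 2 ≤ sqSum n g :=
  Finset.single_le_sum (f := fun m => ‖taylorCoeff g m‖ ^ 2) (fun _ _ => by positivity)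
    (Finset.mem_range.2 hmn)

theorem sum_norm_taylorCoeff_mul_sq_le (hη : DifferentiableOn ℂ η disk)
    (hη1 : ∀ z ∈ disk, ‖η z‖ ≤ 1) (hg : DifferentiableOn ℂ g disk) (n : ℕ)
    (hr : 0 < r) (hr1 : r < 1) :
    ∑ m ∈ Finset.range n, r ^ (2 * m) * ‖taylorCoeff (fun z => η z * g z) m‖ ^ 2 ≤
      ∑ m ∈ Finset.range n, r ^ (2 * m) * ‖taylorCoeff g m‖ ^ 2 := by
  have hT := (differentiable_taylorSum n g).differentiableOn (s := disk)
  have hcoeff (m : ℕ) (hm : m < n) : taylorCoeff (fun z => η z * g z) m =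
      taylorCoeff (fun z => η z * taylorSum n g z) m := by
    have han {k : ℂ → ℂ} (hk : DifferentiableOn ℂ k disk) := analyticAt_of_mem_disk hk zero_mem_disk
    rw [taylorCoeff_mul (han hη) (han hg), taylorCoeff_mul (han hη) (han hT)]
    exact Finset.sum_congr rfl fun i _ => by
      rw [taylorCoeff_taylorSum ((Nat.sub_le m i).trans_lt hm)]
  calc ∑ m ∈ Finset.range n, r ^ (2 * m) * ‖taylorCoeff (fun z => η z * g z) m‖ ^ 2
    _ = ∑ m ∈ Finset.range n,
          r ^ (2 * m) * ‖taylorCoeff (fun z => η z * taylorSum n g z) m‖ ^ 2 :=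
        Finset.sum_congr rfl fun m hm => by rw [hcoeff m (Finset.mem_range.1 hm)]
    _ ≤ Real.circleAverage (fun z => ‖η z * taylorSum n g z‖ ^ 2) 0 r :=
        sum_norm_taylorCoeff_sq_le_circleAverage (hη.fun_mul hT) n hr hr1
    _ ≤ Real.circleAverage (fun z => ‖taylorSum n g z‖ ^ 2) 0 r := by
        refine Real.circleAverage_mono (circleIntegrable_of_continuousOn_disk
          ((hη.fun_mul hT).continuousOn.norm.pow 2) hr hr1) (circleIntegrable_of_continuousOn_disk
          (hT.continuousOn.norm.pow 2) hr hr1) fun z hz => ?_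
        have hz1 : z ∈ disk :=
          mem_disk.2 (by rwa [mem_sphere_zero_iff_norm.1 hz, abs_of_pos hr])
        rw [norm_mul]
        gcongr
        exact mul_le_of_le_one_left (norm_nonneg _) (hη1 z hz1)
    _ = _ := circleAverage_norm_sq_taylorSum g n hr hr1

theorem sqSum_mul_le (hη : DifferentiableOn ℂ η disk) (hη1 : ∀ z ∈ disk, ‖η z‖ ≤ 1)
    (hg : DifferentiableOn ℂ g disk) (n : ℕ) : sqSum n (fun z => η z * g z) ≤ sqSum n g := by
  have hlim (b : ℕ → ℝ) : Tendsto (fun r : ℝ => ∑ m ∈ Finset.range n, r ^ (2 * m) * b m)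
      (𝓝[<] 1) (𝓝 (∑ m ∈ Finset.range n, b m)) := by
    have hcont : Continuous fun r : ℝ => ∑ m ∈ Finset.range n, r ^ (2 * m) * b m := by fun_prop
    simpa only [one_pow, one_mul] using (hcont.tendsto 1).mono_left nhdsWithin_le_nhds
  refine le_of_tendsto_of_tendsto (hlim _) (hlim _) ?_
  filter_upwards [Ioo_mem_nhdsLT (zero_lt_one' ℝ)] with r hr
  exact sum_norm_taylorCoeff_mul_sq_le hη hη1 hg n hr.1 hr.2

/-! ### Coefficients of subordinate functions -/

theorem IsSchwarz.norm_dslope_le (hω : IsSchwarz ω) (hz : z ∈ disk) : ‖dslope ω 0 z‖ ≤ 1 := by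
  have hmaps : MapsTo ω (ball 0 1) (closedBall (ω 0) 1) := by
    rw [hω.map_zero]
    exact hω.mapsTo.mono_right ball_subset_closedBall
  simpa using Complex.norm_dslope_le_div_of_mapsTo_ball hω.analytic hmaps hz

theorem IsSchwarz.differentiableOn_comp (hω : IsSchwarz ω) (hF : DifferentiableOn ℂ F disk) :
    DifferentiableOn ℂ (fun z => F (ω z)) disk :=
  hF.fun_comp hω.analytic hω.mapsTo

theorem IsSchwarz.sqSum_comp_le (hω : IsSchwarz ω) (hF : DifferentiableOn ℂ F disk) (n : ℕ) :
    sqSum n (fun z => F (ω z)) ≤ sqSum n F := by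
  induction n generalizing F with
  | zero => simp [sqSum]
  | succ n ih =>
    have hd := differentiableOn_dslope_zero hF
    have hη := differentiableOn_dslope_zero hω.analytic
    have hcomp := hω.differentiableOn_comp hd
    have hsplit (z : ℂ) : F (ω z) = F 0 + z * (dslope ω 0 z * dslope F 0 (ω z)) := by
      rw [eq_add_mul_dslope F (ω z), ← mul_assoc, ← eq_mul_dslope_zero hω.map_zero]
    rw [sqSum_congr (.of_forall hsplit), sqSum_congr (.of_forall (eq_add_mul_dslope F)),
      sqSum_succ_const_add_id_mul _ (analyticAt_of_mem_disk (hη.fun_mul hcomp) zero_mem_disk),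
      sqSum_succ_const_add_id_mul _ (analyticAt_of_mem_disk hd zero_mem_disk)]
    grw [sqSum_mul_le hη (fun z hz => hω.norm_dslope_le hz) hcomp n, ih hd]

/-- **Rogosinski's inequality**. -/
theorem Subordinate.sqSum_le (hsub : Subordinate g F) (hF : DifferentiableOn ℂ F disk) (n : ℕ) :
    sqSum n g ≤ sqSum n F := by
  obtain ⟨ω, hω, heq⟩ := subordinate_iff.1 hsub
  rw [sqSum_congr (heq.eventuallyEq_of_mem (disk_mem_nhds zero_mem_disk))]
  exact hω.sqSum_comp_le hF n

theorem IsSchwarz.norm_taylorCoeff_le_one (hω : IsSchwarz ω) (m : ℕ) : ‖taylorCoeff ω m‖ ≤ 1 := by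
  have hid : sqSum (m + 1) (fun z => z ^ 1) ≤ 1 := by
    simp only [sqSum, taylorCoeff_pow, apply_ite (‖·‖ ^ 2), norm_one, norm_zero, one_pow, ne_eq,
      OfNat.ofNat_ne_zero, not_false_eq_true, zero_pow, Finset.sum_ite_eq']
    split_ifs <;> norm_num
  have hle := hω.sqSum_comp_le (F := fun z => z ^ 1) (by fun_prop) (m + 1)
  simp only [pow_one] at hle hid
  exact (sq_le_one_iff₀ (norm_nonneg _)).1
    ((norm_taylorCoeff_sq_le_sqSum m.lt_succ_self ω).trans (hle.trans hid))

theorem taylorCoeff_mul_of_forall_lt (hg : AnalyticAt ℂ g 0) (hh : AnalyticAt ℂ h 0)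
    (hzero : ∀ j < m, taylorCoeff g j = 0) :
    taylorCoeff (fun z => g z * h z) m = taylorCoeff g m * h 0 := by
  rw [taylorCoeff_mul hg hh, Finset.sum_range_succ, Finset.sum_eq_zero fun j hj => by
    rw [hzero j (Finset.mem_range.1 hj), zero_mul], Nat.sub_self, taylorCoeff_zero, zero_add]

theorem Subordinate.norm_taylorCoeff_le_of_forall_lt (hsub : Subordinate g F)
    (hF : DifferentiableOn ℂ F disk) (hF' : deriv F 0 ≠ 0) (hm : 1 ≤ m)
    (hzero : ∀ j, 1 ≤ j → j < m → taylorCoeff g j = 0) : ‖taylorCoeff g m‖ ≤ ‖deriv F 0‖ := by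
  obtain ⟨ω, hω, heq⟩ := subordinate_iff.1 hsub
  have hd := hω.differentiableOn_comp (differentiableOn_dslope_zero hF)
  have hE := analyticAt_of_mem_disk hd zero_mem_disk
  have hE0 : dslope F 0 (ω 0) = deriv F 0 := by rw [hω.map_zero, dslope_same]
  have hg0 : g 0 = F 0 := by simpa [hω.map_zero] using heq zero_mem_disk
  have hg : AnalyticAt ℂ g 0 := analyticAt_of_mem_disk
    ((hω.differentiableOn_comp hF).congr heq) zero_mem_disk
  have hsucc (j : ℕ) : taylorCoeff (fun z => -F 0 + g z) (j + 1) = taylorCoeff g (j + 1) :=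
    taylorCoeff_const_add_succ ..
  have hdiv : ω =ᶠ[𝓝 0] fun z => (-F 0 + g z) * (dslope F 0 (ω z))⁻¹ := by
    filter_upwards [disk_mem_nhds zero_mem_disk,
      hE.continuousAt.eventually_ne (by rwa [hE0])] with z hz hne
    rw [heq hz, Function.comp_apply, eq_add_mul_dslope F (ω z), neg_add_cancel_left,
      mul_inv_cancel_right₀ hne]
  obtain ⟨m, rfl⟩ := Nat.exists_eq_add_of_le' hm
  have hcoeff : taylorCoeff ω (m + 1) = taylorCoeff g (m + 1) * (deriv F 0)⁻¹ := by
    rw [taylorCoeff_congr hdiv, taylorCoeff_mul_of_forall_lt (analyticAt_const.fun_add hg)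
      (hE.fun_inv (by rwa [hE0])), hsucc, hE0]
    rintro (_ | j) hj
    · rw [taylorCoeff_zero, hg0, neg_add_cancel]
    · rw [hsucc, hzero _ j.succ_pos hj]
  rw [← mul_inv_cancel_right₀ hF' (taylorCoeff g (m + 1)), mul_right_comm, ← hcoeff, norm_mul]
  exact mul_le_of_le_one_left (norm_nonneg _) (hω.norm_taylorCoeff_le_one _)

/-- The mean of `g` over the rotations by the `m`-th roots of unity. It keeps the Taylor
coefficients of `g` whose index is divisible by `m` and kills all others. -/
noncomputable def rotationMean (m : ℕ) (g : ℂ → ℂ) (z : ℂ) : ℂ :=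
  (m : ℂ)⁻¹ * ∑ k ∈ Finset.range m, g (Complex.exp (2 * Real.pi * Complex.I / m) ^ k * z)

theorem taylorCoeff_rotationMean (hg : AnalyticAt ℂ g 0) (m j : ℕ) :
    taylorCoeff (rotationMean m g) j = (m : ℂ)⁻¹ *
      (∑ k ∈ Finset.range m, (Complex.exp (2 * Real.pi * Complex.I / m) ^ j) ^ k) *
        taylorCoeff g j := by
  unfold rotationMean
  rw [taylorCoeff_const_mul, taylorCoeff_sum fun k _ =>
    AnalyticAt.fun_comp (by simpa using hg) (by fun_prop), mul_assoc (m : ℂ)⁻¹,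
    Finset.sum_mul]
  simp only [taylorCoeff_comp_mul hg, ← pow_mul, mul_comm j]

theorem taylorCoeff_rotationMean_of_lt (hg : AnalyticAt ℂ g 0) (hj : 1 ≤ j) (hjm : j < m) :
    taylorCoeff (rotationMean m g) j = 0 := by
  have hprim := Complex.isPrimitiveRoot_exp m (by lia)
  rw [taylorCoeff_rotationMean hg, geom_sum_eq (hprim.pow_ne_one_of_pos_of_lt (by lia) hjm),
    ← pow_mul, mul_comm j m, pow_mul, hprim.pow_eq_one]
  simp

theorem taylorCoeff_rotationMean_self (hg : AnalyticAt ℂ g 0) (hm : m ≠ 0) :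
    taylorCoeff (rotationMean m g) m = taylorCoeff g m := by
  rw [taylorCoeff_rotationMean hg, (Complex.isPrimitiveRoot_exp m hm).pow_eq_one]
  simp [hm]

theorem rotationMean_zero (hm : m ≠ 0) (g : ℂ → ℂ) : rotationMean m g 0 = g 0 := by
  simp [rotationMean, hm]

theorem root_of_unity_mul_mem_disk (m k : ℕ) (hz : z ∈ disk) :
    Complex.exp (2 * Real.pi * Complex.I / m) ^ k * z ∈ disk := by
  have hnorm : ‖Complex.exp (2 * Real.pi * Complex.I / m)‖ = 1 := by
    simp [Complex.norm_exp]
  rwa [mem_disk, norm_mul, norm_pow, hnorm, one_pow, one_mul, ← mem_disk]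

theorem differentiableOn_rotationMean (hg : DifferentiableOn ℂ g disk) (m : ℕ) :
    DifferentiableOn ℂ (rotationMean m g) disk :=
  (DifferentiableOn.fun_sum fun k _ => hg.fun_comp (by fun_prop)
    fun _ hz => root_of_unity_mul_mem_disk m k hz).const_mul _

theorem rotationMean_mem {S : Set ℂ} (hS : Convex ℝ S) (hg : MapsTo g disk S) (hm : m ≠ 0)
    (hz : z ∈ disk) : rotationMean m g z ∈ S := by
  have hmean := hS.sum_mem (t := Finset.range m) (w := fun _ => (m : ℝ)⁻¹)
    (fun _ _ => by positivity) (by simp [hm])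
    fun k _ => hg (root_of_unity_mul_mem_disk m k hz)
  rw [← Finset.smul_sum, Complex.real_smul] at hmean
  simpa [rotationMean] using hmean

theorem Subordinate.norm_taylorCoeff_le_of_convex (hsub : Subordinate g F)
    (hF : UnivalentOn F disk) (hconv : Convex ℝ (F '' disk)) (hm : 1 ≤ m) :
    ‖taylorCoeff g m‖ ≤ ‖deriv F 0‖ := by
  obtain ⟨ω, hω, heq⟩ := subordinate_iff.1 hsub
  have hg : DifferentiableOn ℂ g disk := (hω.differentiableOn_comp hF.analytic).congr heq
  have hg0 : AnalyticAt ℂ g 0 := analyticAt_of_mem_disk hg zero_mem_disk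
  have hm0 : m ≠ 0 := by lia
  have hmaps : MapsTo g disk (F '' disk) := fun z hz => heq hz ▸ mem_image_of_mem F (hω.mapsTo hz)
  have hmean : Subordinate (rotationMean m g) F :=
    hF.subordinate_of_mapsTo (differentiableOn_rotationMean hg m)
      (by simpa [rotationMean_zero hm0, hω.map_zero] using heq zero_mem_disk)
      fun z hz => rotationMean_mem hconv hmaps hm0 hz
  rw [← taylorCoeff_rotationMean_self hg0 hm0]
  exact hmean.norm_taylorCoeff_le_of_forall_lt hF.analytic (hF.deriv_ne_zero zero_mem_disk) hm
    fun j hj hjm => taylorCoeff_rotationMean_of_lt hg0 hj hjm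

/-! ### Subordination to functions with starlike image -/

theorem norm_one_sub_le_norm_one_add {w : ℂ} (hw : 0 ≤ w.re) : ‖1 - w‖ ≤ ‖1 + w‖ := by
  rw [← sq_le_sq₀ (norm_nonneg _) (norm_nonneg _), ← Complex.normSq_eq_norm_sq,
    ← Complex.normSq_eq_norm_sq, Complex.normSq_apply, Complex.normSq_apply]
  simp only [Complex.sub_re, Complex.add_re, Complex.sub_im, Complex.add_im, Complex.one_re,
    Complex.one_im]
  linarith

theorem exists_isSchwarz_cayley (hR : DifferentiableOn ℂ R disk) (h0 : R 0 = 1)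
    (hre : ∀ z ∈ disk, 0 ≤ (R z).re) :
    ∃ v, IsSchwarz v ∧ ∀ z ∈ disk, v z * (1 + R z) = 1 - R z := by
  have hne (z : ℂ) (hz : z ∈ disk) : 1 + R z ≠ 0 := fun hzero => by
    have hre_add := congr_arg Complex.re hzero
    rw [Complex.add_re, Complex.one_re, Complex.zero_re] at hre_add
    linarith [hre z hz]
  have hv : DifferentiableOn ℂ (fun z => (1 - R z) / (1 + R z)) disk :=
    (hR.const_sub 1).fun_div (hR.const_add 1) hne
  have hmaps : MapsTo (fun z => (1 - R z) / (1 + R z)) (ball 0 1) (closedBall 0 1) := fun z hz => by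
    rw [mem_closedBall_zero_iff, norm_div]
    exact div_le_one_of_le₀ (norm_one_sub_le_norm_one_add (hre z hz)) (norm_nonneg _)
  refine ⟨_, ⟨hv, by simp [h0], fun z hz => mem_disk.2 ?_⟩,
    fun z hz => div_mul_cancel₀ _ (hne z hz)⟩
  exact (Complex.norm_le_norm_of_mapsTo_ball hv hmaps (by simp [h0]) (mem_disk.1 hz)).trans_lt
    (mem_disk.1 hz)

theorem exists_differentiableOn_sq_eq (hF : DifferentiableOn ℂ F disk)
    (hne : ∀ z ∈ disk, F z ≠ 0) :
    ∃ h, DifferentiableOn ℂ h disk ∧ ∀ z ∈ disk, h z ^ 2 = F z := by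
  obtain ⟨ℓ, hℓ0, hℓ⟩ :=
    ((hF.deriv isOpen_ball).fun_div (hF.const_mul 2) fun z hz =>
      mul_ne_zero two_ne_zero (hne z hz)).isExactOn_ball.with_val_at 0 0
  obtain ⟨c, hc⟩ := IsAlgClosed.exists_pow_nat_eq (F 0) two_pos
  refine ⟨fun z => c * Complex.exp (ℓ z), fun z hz =>
    ((hℓ z hz).cexp.const_mul c).differentiableAt.differentiableWithinAt, fun z hz => ?_⟩
  have hder (x : ℂ) (hx : x ∈ disk) : HasDerivAt (fun y => F y * Complex.exp (-ℓ y) ^ 2) 0 x := by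
    have hFx := (differentiableAt_of_mem_disk hF hx).hasDerivAt
    refine (hFx.fun_mul ((hℓ x hx).fun_neg.cexp.fun_pow 2)).congr_deriv ?_
    have hFne := hne x hx
    push_cast
    field_simp
    ring
  have hconst := isOpen_ball.is_const_of_deriv_eq_zero (convex_ball (0 : ℂ) 1).isPreconnected
    (fun x hx => (hder x hx).differentiableAt.differentiableWithinAt)
    (fun x hx => (hder x hx).deriv) hz zero_mem_disk
  simp only [hℓ0, neg_zero, Complex.exp_zero, one_pow, mul_one, Complex.exp_neg] at hconst
  rw [mul_pow, hc, ← hconst]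
  field_simp [Complex.exp_ne_zero]

namespace UnivalentOn

theorem dslope_ne_zero (hF : UnivalentOn F disk) (hz : z ∈ disk) : dslope F 0 z ≠ 0 := by
  obtain rfl | hz0 := eq_or_ne z 0
  · rw [dslope_same]
    exact hF.deriv_ne_zero zero_mem_disk
  · intro hzero
    have hFz := eq_add_mul_dslope F z
    rw [hzero, mul_zero, add_zero] at hFz
    exact hz0 (hF.injOn hz zero_mem_disk hFz)

theorem dslope_div_deriv_re_nonneg_of_starConvex (hF : UnivalentOn F disk)
    (hstar : StarConvex ℝ (F 0) (F '' disk)) (hz : z ∈ disk) :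
    0 ≤ (dslope F 0 z / deriv F z).re := by
  have hF' := hF.deriv_ne_zero hz
  obtain rfl | hz0 := eq_or_ne z 0
  · simp [dslope_same, div_self hF']
  · have hquot : (F 0 - F z) / (z * deriv F z) = -(dslope F 0 z / deriv F z) := by
      rw [eq_add_mul_dslope F z]
      field_simp
      ring
    have hle := hF.re_sub_div_nonpos_of_starConvex hstar hz hz0
    rwa [hquot, Complex.neg_re, neg_nonpos] at hle

theorem exists_sqrt_of_starConvex (hF : UnivalentOn F disk)
    (hstar : StarConvex ℝ (F 0) (F '' disk)) :
    ∃ h v, DifferentiableOn ℂ h disk ∧ IsSchwarz v ∧ (∀ z ∈ disk, h z ^ 2 = dslope F 0 z) ∧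
      ∀ z ∈ disk, z * deriv h z = v z * deriv (fun x => x * h x) z := by
  have hD := differentiableOn_dslope_zero hF.analytic
  have hF' : ∀ z ∈ disk, deriv F z ≠ 0 := fun z hz => hF.deriv_ne_zero hz
  obtain ⟨v, hv, hveq⟩ := exists_isSchwarz_cayley
    (hD.fun_div (hF.analytic.deriv isOpen_ball) hF')
    (by rw [dslope_same, div_self (hF' 0 zero_mem_disk)])
    fun z hz => hF.dslope_div_deriv_re_nonneg_of_starConvex hstar hz
  obtain ⟨h, hh, hsq⟩ := exists_differentiableOn_sq_eq hD fun z hz => hF.dslope_ne_zero hz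
  refine ⟨h, v, hh, hv, hsq, fun z hz => ?_⟩
  have hhz := (differentiableAt_of_mem_disk hh hz).hasDerivAt
  have hFz : deriv F z = h z ^ 2 + z * (2 * h z * deriv h z) := by
    have hsplit : F =ᶠ[𝓝 z] fun x => F 0 + x * h x ^ 2 := by
      filter_upwards [disk_mem_nhds hz] with x hx
      rw [hsq x hx, ← eq_add_mul_dslope]
    rw [hsplit.deriv_eq, (((hasDerivAt_id' z).fun_mul (hhz.fun_pow 2)).const_add (F 0)).deriv]
    simp
  have hne : h z ≠ 0 := fun hzero =>
    hF.dslope_ne_zero hz (by rw [← hsq z hz, hzero, zero_pow two_ne_zero])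
  have hcayley := hveq z hz
  have hF'z := hF' z hz
  rw [← hsq z hz] at hcayley
  field_simp at hcayley
  rw [((hasDerivAt_id' z).fun_mul hhz).deriv, one_mul]
  apply mul_left_cancel₀ (mul_ne_zero two_ne_zero hne)
  rw [hFz] at hcayley
  linear_combination -hcayley

end UnivalentOn

theorem le_apply_zero_of_sum_succ_sq_mul_le {a : ℕ → ℝ}
    (ha : ∀ n, ∑ k ∈ Finset.range n, (k + 1 : ℝ) ^ 2 * a (k + 1) ≤
      ∑ k ∈ Finset.range n, (k + 1 : ℝ) ^ 2 * a k) (n : ℕ) : a n ≤ a 0 := by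
  induction n using Nat.strong_induction_on with
  | _ n ih =>
    obtain rfl | hn := Nat.eq_zero_or_pos n
    · rfl
    have htel := Finset.sum_range_sub (fun k : ℕ => (k : ℝ) ^ 2 * a k) n
    have hodd := Finset.sum_range_sub (fun k : ℕ => (k : ℝ) ^ 2 * a 0) n
    have hle : ∑ k ∈ Finset.range n, ((k + 1 : ℝ) ^ 2 - (k : ℝ) ^ 2) * a k ≤
        ∑ k ∈ Finset.range n, ((k + 1 : ℝ) ^ 2 - (k : ℝ) ^ 2) * a 0 :=
      Finset.sum_le_sum fun k hk =>
        mul_le_mul_of_nonneg_left (ih k (Finset.mem_range.1 hk))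
          (by linarith [k.cast_nonneg (α := ℝ)])
    have hsum := ha n
    simp only [Finset.sum_sub_distrib, sub_mul, Nat.cast_add, Nat.cast_one, Nat.cast_zero]
      at htel hodd hle hsum
    have hpos : 0 < (n : ℝ) ^ 2 := by positivity
    exact le_of_mul_le_mul_left (by linarith) hpos

theorem IsSchwarz.norm_taylorCoeff_le_of_mul_deriv_eq (hv : IsSchwarz v)
    (hh : DifferentiableOn ℂ h disk)
    (heq : ∀ z ∈ disk, z * deriv h z = v z * deriv (fun x => x * h x) z) (n : ℕ) :
    ‖taylorCoeff h n‖ ≤ ‖h 0‖ := by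
  have hη := differentiableOn_dslope_zero hv.analytic
  have hG : DifferentiableOn ℂ (deriv fun x => x * h x) disk :=
    (differentiableOn_id.fun_mul hh).deriv isOpen_ball
  have hh0 := analyticAt_of_mem_disk hh zero_mem_disk
  have hderiv (k : ℕ) : taylorCoeff (deriv h) k =
      taylorCoeff (fun z => dslope v 0 z * deriv (fun x => x * h x) z) k := by
    rw [← taylorCoeff_id_mul_succ hh0.deriv, ← taylorCoeff_id_mul_succ
      (analyticAt_of_mem_disk (hη.fun_mul hG) zero_mem_disk)]
    refine taylorCoeff_congr ?_ _
    filter_upwards [disk_mem_nhds zero_mem_disk] with z hz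
    rw [heq z hz, ← mul_assoc, ← eq_mul_dslope_zero hv.map_zero]
  have hsq : ‖taylorCoeff h n‖ ^ 2 ≤ ‖taylorCoeff h 0‖ ^ 2 := by
    refine le_apply_zero_of_sum_succ_sq_mul_le (a := fun k => ‖taylorCoeff h k‖ ^ 2) (fun n => ?_) n
    have hle := sqSum_mul_le hη (fun z hz => hv.norm_dslope_le hz) hG n
    have hnorm (k : ℕ) : ‖(k : ℂ) + 1‖ = k + 1 := by exact_mod_cast Complex.norm_natCast (k + 1)
    simpa only [sqSum, ← hderiv, taylorCoeff_deriv, taylorCoeff_id_mul_succ hh0, norm_mul, mul_pow,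
      hnorm] using hle
  rwa [taylorCoeff_zero, sq_le_sq₀ (norm_nonneg _) (norm_nonneg _)] at hsq

theorem norm_taylorCoeff_mul_le (hg : AnalyticAt ℂ g 0) (hh : AnalyticAt ℂ h 0) (n : ℕ) :
    ‖taylorCoeff (fun z => g z * h z) n‖ ≤ (sqSum (n + 1) g + sqSum (n + 1) h) / 2 := by
  have hreflect := Finset.sum_range_reflect (fun i => ‖taylorCoeff h i‖ ^ 2) (n + 1)
  simp only [Nat.add_sub_cancel] at hreflect
  rw [taylorCoeff_mul hg hh, sqSum, sqSum, ← hreflect, ← Finset.sum_add_distrib, Finset.sum_div]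
  refine norm_sum_le_of_le _ fun i _ => ?_
  rw [norm_mul]
  linarith [two_mul_le_add_sq ‖taylorCoeff g i‖ ‖taylorCoeff h (n - i)‖]

theorem Subordinate.norm_taylorCoeff_le_of_starConvex (hsub : Subordinate g F)
    (hF : UnivalentOn F disk) (hstar : StarConvex ℝ (F 0) (F '' disk)) (hm : 1 ≤ m) :
    ‖taylorCoeff g m‖ ≤ m * ‖deriv F 0‖ := by
  obtain ⟨n, rfl⟩ := Nat.exists_eq_add_of_le' hm
  obtain ⟨ω, hω, heq⟩ := subordinate_iff.1 hsub
  obtain ⟨h, v, hh, hv, hsq, hode⟩ := hF.exists_sqrt_of_starConvex hstar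
  have hη := differentiableOn_dslope_zero hω.analytic
  have hH := hω.differentiableOn_comp hh
  have hηH := hη.fun_mul hH
  have h0 : ‖h 0‖ ^ 2 = ‖deriv F 0‖ := by rw [← norm_pow, hsq 0 zero_mem_disk, dslope_same]
  have hbound : sqSum (n + 1) (fun z => h (ω z)) ≤ (n + 1 : ℕ) * ‖deriv F 0‖ := by
    refine (hω.sqSum_comp_le hh _).trans ?_
    rw [← h0, ← nsmul_eq_mul]
    refine Finset.sum_le_card_nsmul _ _ _ (fun k _ => ?_) |>.trans_eq (by rw [Finset.card_range])
    exact pow_le_pow_left₀ (norm_nonneg _) (hv.norm_taylorCoeff_le_of_mul_deriv_eq hh hode k) 2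
  have hsplit : g =ᶠ[𝓝 0] fun z => F 0 + z * (dslope ω 0 z * h (ω z) * h (ω z)) := by
    filter_upwards [disk_mem_nhds zero_mem_disk] with z hz
    have hωz := eq_mul_dslope_zero hω.map_zero z
    rw [heq hz, Function.comp_apply, eq_add_mul_dslope F (ω z), ← hsq _ (hω.mapsTo hz)]
    linear_combination h (ω z) ^ 2 * hωz
  have hHan := analyticAt_of_mem_disk hH zero_mem_disk
  have hηHan := analyticAt_of_mem_disk hηH zero_mem_disk
  rw [taylorCoeff_congr hsplit, taylorCoeff_const_add_succ,
    taylorCoeff_id_mul_succ (hηHan.fun_mul hHan)]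
  have hprod := norm_taylorCoeff_mul_le hηHan hHan n
  have hηle := sqSum_mul_le hη (fun z hz => hω.norm_dslope_le hz) hH (n + 1)
  linarith

/-! ### Logarithmic coefficients of starlike functions -/

theorem deriv_eq_dslope_add_mul_deriv (hf : DifferentiableOn ℂ f disk) (hz : z ∈ disk) :
    deriv f z = dslope f 0 z + z * deriv (dslope f 0) z := by
  have hd := (differentiableAt_of_mem_disk (differentiableOn_dslope_zero hf) hz).hasDerivAt
  have hsplit := (((hasDerivAt_id' z).fun_mul hd).const_add (f 0)).congr_of_eventuallyEq
    (.of_forall (eq_add_mul_dslope f))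
  rw [hsplit.deriv, one_mul]

namespace Normalized

theorem dslope_zero (hf : Normalized f) : dslope f 0 0 = 1 := by rw [dslope_same, hf.deriv_zero]

theorem logCoeff_eq (hf : Normalized f) (hm : 1 ≤ m) :
    logCoeff f m = taylorCoeff (fun z => deriv f z / dslope f 0 z) m / (2 * m) := by
  obtain ⟨n, rfl⟩ := Nat.exists_eq_add_of_le' hm
  have hd := differentiableOn_dslope_zero hf.analytic
  have hd0 := analyticAt_of_mem_disk hd zero_mem_disk
  have hslit : dslope f 0 0 ∈ Complex.slitPlane := hf.dslope_zero ▸ Complex.one_mem_slitPlane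
  have hlog : (fun z => deriv f z / dslope f 0 z) =ᶠ[𝓝 0]
      fun z => 1 + z * deriv (fun z => Complex.log (dslope f 0 z)) z := by
    filter_upwards [disk_mem_nhds zero_mem_disk,
      hd0.continuousAt (Complex.isOpen_slitPlane.mem_nhds hslit)] with z hz hzslit
    have hne : dslope f 0 z ≠ 0 := Complex.slitPlane_ne_zero hzslit
    rw [((differentiableAt_of_mem_disk hd hz).hasDerivAt.clog hzslit).deriv,
      deriv_eq_dslope_add_mul_deriv hf.analytic hz]
    field_simp
  rw [taylorCoeff_congr hlog, taylorCoeff_const_add_succ,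
    taylorCoeff_id_mul_succ (hd0.clog hslit).deriv, taylorCoeff_deriv, logCoeff]
  have hn : (n : ℂ) + 1 ≠ 0 := Nat.cast_add_one_ne_zero n
  push_cast
  field_simp

theorem norm_logCoeff (hf : Normalized f) (hm : 1 ≤ m) : ‖logCoeff f m‖ =
    ‖taylorCoeff (fun z => deriv f z / dslope f 0 z) m‖ / (2 * m) := by
  simp [hf.logCoeff_eq hm]

theorem norm_logCoeff_succ_sq (hf : Normalized f) (k : ℕ) : ‖logCoeff f (k + 1)‖ ^ 2 =
    1 / 4 * (‖taylorCoeff (fun z => deriv f z / dslope f 0 z) (k + 1)‖ ^ 2 /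
      ((k + 1 : ℕ) : ℝ) ^ 2) := by
  rw [hf.norm_logCoeff k.succ_pos]
  ring

end Normalized

/-- The Ma–Minda class `S*(ψ)` of starlike functions: normalized `f` with `z f' / f ≺ ψ`. The
quotient is written `deriv f / dslope f 0`, which removes the singularity at the origin. -/
structure StarlikeClass (ψ f : ℂ → ℂ) : Prop where
  normalized : Normalized f
  subordinate : Subordinate (fun z => deriv f z / dslope f 0 z) ψ

theorem sum_mul_nonneg_of_antitone {w d : ℕ → ℝ} (hw : Antitone w) (hw0 : ∀ n, 0 ≤ w n)
    (hd : ∀ n, 0 ≤ ∑ i ∈ Finset.range n, d i) (n : ℕ) :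
    0 ≤ ∑ i ∈ Finset.range n, w i * d i := by
  have hparts := Finset.sum_range_by_parts w d n
  simp only [smul_eq_mul] at hparts
  rw [hparts]
  exact sub_nonneg.2 ((Finset.sum_nonpos fun i _ => mul_nonpos_of_nonpos_of_nonneg
    (sub_nonpos.2 (hw i.le_succ)) (hd _)).trans (mul_nonneg (hw0 _) (hd _)))

theorem sqSum_succ (g : ℂ → ℂ) (n : ℕ) :
    sqSum (n + 1) g = ∑ k ∈ Finset.range n, ‖taylorCoeff g (k + 1)‖ ^ 2 + ‖g 0‖ ^ 2 := by
  rw [sqSum, Finset.sum_range_succ', taylorCoeff_zero]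

theorem Subordinate.sum_norm_taylorCoeff_sq_div_le (hsub : Subordinate g ψ)
    (hψ : DifferentiableOn ℂ ψ disk) (n : ℕ) :
    ∑ k ∈ Finset.range n, ‖taylorCoeff g (k + 1)‖ ^ 2 / ((k + 1 : ℕ) : ℝ) ^ 2 ≤
      ∑ k ∈ Finset.range n, ‖taylorCoeff ψ (k + 1)‖ ^ 2 / ((k + 1 : ℕ) : ℝ) ^ 2 := by
  have hanti : Antitone fun k : ℕ => (((k + 1 : ℕ) : ℝ) ^ 2)⁻¹ := fun a b hab => by
    simp only
    gcongr
  have h0 : g 0 = ψ 0 := by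
    obtain ⟨ω, hω, heq⟩ := subordinate_iff.1 hsub
    simpa [hω.map_zero] using heq zero_mem_disk
  have hnonneg := sum_mul_nonneg_of_antitone hanti (fun _ => by positivity)
    (d := fun k => ‖taylorCoeff ψ (k + 1)‖ ^ 2 - ‖taylorCoeff g (k + 1)‖ ^ 2) (fun j => by
      have hle := hsub.sqSum_le hψ (j + 1)
      rw [sqSum_succ, sqSum_succ, h0] at hle
      rw [Finset.sum_sub_distrib]
      linarith) n
  simp only [mul_sub, Finset.sum_sub_distrib, sub_nonneg] at hnonneg
  simpa only [div_eq_inv_mul] using hnonneg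

theorem UnivalentOn.summable_norm_taylorCoeff_sq_div (hψ : UnivalentOn ψ disk)
    (hconv : Convex ℝ (ψ '' disk)) :
    Summable fun k : ℕ => ‖taylorCoeff ψ (k + 1)‖ ^ 2 / ((k + 1 : ℕ) : ℝ) ^ 2 := by
  have hself : Subordinate ψ ψ :=
    hψ.subordinate_of_mapsTo hψ.analytic rfl (mapsTo_image ψ disk)
  have hsum : Summable fun k : ℕ => ‖deriv ψ 0‖ ^ 2 * (1 / ((k + 1 : ℕ) : ℝ) ^ 2) :=
    ((summable_nat_add_iff 1).2 (Real.summable_one_div_nat_pow.2 one_lt_two)).mul_left _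
  refine .of_nonneg_of_le (fun k => by positivity) (fun k => ?_) hsum
  rw [mul_one_div]
  gcongr
  exact hself.norm_taylorCoeff_le_of_convex hψ hconv k.succ_pos

namespace StarlikeClass

theorem norm_logCoeff_le_of_convex (hf : StarlikeClass ψ f) (hψ : UnivalentOn ψ disk)
    (hconv : Convex ℝ (ψ '' disk)) (hm : 1 ≤ m) : ‖logCoeff f m‖ ≤ ‖deriv ψ 0‖ / (2 * m) := by
  rw [hf.normalized.norm_logCoeff hm]
  gcongr
  exact hf.subordinate.norm_taylorCoeff_le_of_convex hψ hconv hm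

theorem norm_logCoeff_le_of_starConvex (hf : StarlikeClass ψ f) (hψ : UnivalentOn ψ disk)
    (hstar : StarConvex ℝ (ψ 0) (ψ '' disk)) (hm : 1 ≤ m) : ‖logCoeff f m‖ ≤ ‖deriv ψ 0‖ / 2 := by
  rw [hf.normalized.norm_logCoeff hm, div_le_iff₀ (by positivity)]
  linarith [hf.subordinate.norm_taylorCoeff_le_of_starConvex hψ hstar hm]

theorem sum_norm_logCoeff_sq_le (hf : StarlikeClass ψ f) (hψ : DifferentiableOn ℂ ψ disk) (n : ℕ) :
    ∑ k ∈ Finset.range n, ‖logCoeff f (k + 1)‖ ^ 2 ≤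
      1 / 4 * ∑ k ∈ Finset.range n, ‖taylorCoeff ψ (k + 1)‖ ^ 2 / ((k + 1 : ℕ) : ℝ) ^ 2 := by
  simp only [hf.normalized.norm_logCoeff_succ_sq, ← Finset.mul_sum]
  refine mul_le_mul_of_nonneg_left ?_ (by norm_num)
  exact hf.subordinate.sum_norm_taylorCoeff_sq_div_le hψ n

theorem sum_norm_logCoeff_sq_le_tsum (hf : StarlikeClass ψ f) (hψ : DifferentiableOn ℂ ψ disk)
    (hsum : Summable fun k : ℕ => ‖taylorCoeff ψ (k + 1)‖ ^ 2 / ((k + 1 : ℕ) : ℝ) ^ 2) (n : ℕ) :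
    ∑ k ∈ Finset.range n, ‖logCoeff f (k + 1)‖ ^ 2 ≤
      1 / 4 * ∑' k : ℕ, ‖taylorCoeff ψ (k + 1)‖ ^ 2 / ((k + 1 : ℕ) : ℝ) ^ 2 := by
  grw [hf.sum_norm_logCoeff_sq_le hψ n]
  gcongr
  exact hsum.sum_le_tsum _ fun _ _ => by positivity

theorem summable_norm_logCoeff_sq (hf : StarlikeClass ψ f) (hψ : DifferentiableOn ℂ ψ disk)
    (hsum : Summable fun k : ℕ => ‖taylorCoeff ψ (k + 1)‖ ^ 2 / ((k + 1 : ℕ) : ℝ) ^ 2) :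
    Summable fun k : ℕ => ‖logCoeff f (k + 1)‖ ^ 2 :=
  summable_of_sum_range_le (fun _ => by positivity) (hf.sum_norm_logCoeff_sq_le_tsum hψ hsum)

end StarlikeClass

theorem BriotBouquetSolution.starlikeClass (hψ : BriotBouquetSolution φ ψ)
    (hφ : UnivalentOn φ disk) (hconv : Convex ℝ (φ '' disk)) (hre : ∀ z ∈ disk, 0 < (φ z).re)
    (hf : ConvexClass φ f) : StarlikeClass ψ f :=
  ⟨hf.normalized, hψ.subordinate_deriv_div_dslope hφ hconv hre hf⟩

/-! ### The extremal function -/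

namespace StarSolution

theorem exists_of_differentiableOn (hψ : DifferentiableOn ℂ ψ disk) (h0 : ψ 0 = 1) :
    ∃ f, StarSolution ψ f := by
  obtain ⟨ℓ, hℓ0, hℓ⟩ := (differentiableOn_dslope_zero hψ).isExactOn_ball.with_val_at 0 0
  have hder : ∀ z ∈ disk,
      HasDerivAt (fun z => z * Complex.exp (ℓ z)) (ψ z * Complex.exp (ℓ z)) z := fun z hz => by
    refine ((hasDerivAt_id' z).fun_mul (hℓ z hz).cexp).congr_deriv ?_
    rw [eq_add_mul_dslope ψ z, h0]
    ring
  refine ⟨fun z => z * Complex.exp (ℓ z),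
    ⟨fun z hz => (hder z hz).differentiableAt.differentiableWithinAt, by simp, ?_⟩,
    fun z _ hz0 => mul_ne_zero hz0 (Complex.exp_ne_zero _), fun z hz hz0 => ?_⟩
  · rw [(hder 0 zero_mem_disk).deriv, hℓ0, h0, Complex.exp_zero, one_mul]
  · have hexp := Complex.exp_ne_zero (ℓ z)
    rw [(hder z hz).deriv]
    field_simp

theorem dslope_ne_zero (hf : StarSolution ψ f) (hz : z ∈ disk) : dslope f 0 z ≠ 0 := by
  obtain rfl | hz0 := eq_or_ne z 0
  · rw [hf.normalized.dslope_zero]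
    exact one_ne_zero
  · rw [dslope_zero_eq_div hf.normalized.map_zero hz0]
    exact div_ne_zero (hf.ne_zero z hz hz0) hz0

theorem deriv_div_dslope (hf : StarSolution ψ f) (h0 : ψ 0 = 1) (hz : z ∈ disk) :
    deriv f z / dslope f 0 z = ψ z := by
  obtain rfl | hz0 := eq_or_ne z 0
  · rw [hf.normalized.dslope_zero, hf.normalized.deriv_zero, h0, div_one]
  · rw [dslope_zero_eq_div hf.normalized.map_zero hz0, div_div_eq_mul_div, mul_comm,
      hf.equation z hz hz0]

theorem one_add_mul_deriv_deriv_div (hf : StarSolution ψ f) (hψ : BriotBouquetSolution φ ψ)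
    (h0 : φ 0 = 1) (hz : z ∈ disk) : 1 + z * deriv (deriv f) z / deriv f z = φ z := by
  have hquot (x : ℂ) (hx : x ∈ disk) : deriv f x = ψ x * dslope f 0 x :=
    (div_eq_iff (hf.dslope_ne_zero hx)).1 (hf.deriv_div_dslope (hψ.map_zero.trans h0) hx)
  have hprod : deriv f =ᶠ[𝓝 z] fun x => ψ x * dslope f 0 x := by
    filter_upwards [disk_mem_nhds hz] with x hx using hquot x hx
  have hψ' := (differentiableAt_of_mem_disk hψ.analytic hz).hasDerivAt
  have hd' := (differentiableAt_of_mem_disk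
    (differentiableOn_dslope_zero hf.normalized.analytic) hz).hasDerivAt
  have hsplit := deriv_eq_dslope_add_mul_deriv hf.normalized.analytic hz
  have hψne := hψ.ne_zero z hz
  have hdne := hf.dslope_ne_zero hz
  rw [hquot z hz] at hsplit
  rw [hprod.deriv_eq, (hψ'.fun_mul hd').deriv, hquot z hz, ← hψ.equation z hz]
  field_simp
  linear_combination -ψ z * hsplit

theorem convexClass (hf : StarSolution ψ f) (hψ : BriotBouquetSolution φ ψ) (h0 : φ 0 = 1) :
    ConvexClass φ f := by
  refine ⟨hf.normalized, fun z hz hzero => hψ.ne_zero z hz ?_, id, differentiableOn_id, rfl,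
    fun z hz => hz, fun z hz => hf.one_add_mul_deriv_deriv_div hψ h0 hz⟩
  rw [← hf.deriv_div_dslope (hψ.map_zero.trans h0) hz, hzero, zero_div]

theorem taylorCoeff_deriv_div_dslope (hf : StarSolution ψ f) (h0 : ψ 0 = 1) (m : ℕ) :
    taylorCoeff (fun z => deriv f z / dslope f 0 z) m = taylorCoeff ψ m := by
  refine taylorCoeff_congr ?_ m
  filter_upwards [disk_mem_nhds zero_mem_disk] with z hz using hf.deriv_div_dslope h0 hz

theorem logCoeff_eq (hf : StarSolution ψ f) (h0 : ψ 0 = 1) (hm : 1 ≤ m) :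
    logCoeff f m = taylorCoeff ψ m / (2 * m) := by
  rw [hf.normalized.logCoeff_eq hm, hf.taylorCoeff_deriv_div_dslope h0]

theorem norm_logCoeff (hf : StarSolution ψ f) (h0 : ψ 0 = 1) (hm : 1 ≤ m) :
    ‖logCoeff f m‖ = ‖taylorCoeff ψ m‖ / (2 * m) := by
  rw [hf.normalized.norm_logCoeff hm, hf.taylorCoeff_deriv_div_dslope h0]

theorem norm_logCoeff_one (hf : StarSolution ψ f) (h0 : ψ 0 = 1) :
    ‖logCoeff f 1‖ = ‖deriv ψ 0‖ / 2 := by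
  simp [hf.norm_logCoeff h0 le_rfl, taylorCoeff_one]

theorem norm_logCoeff_eq_iff (hf : StarSolution ψ f) (h0 : ψ 0 = 1) (hm : 1 ≤ m) {c : ℝ} :
    ‖logCoeff f m‖ = c ↔ ‖taylorCoeff ψ m‖ = c * (2 * m) := by
  rw [hf.norm_logCoeff h0 hm, div_eq_iff (by positivity)]

theorem tsum_norm_logCoeff_sq (hf : StarSolution ψ f) (h0 : ψ 0 = 1) :
    ∑' k : ℕ, ‖logCoeff f (k + 1)‖ ^ 2 =
      1 / 4 * ∑' k : ℕ, ‖taylorCoeff ψ (k + 1)‖ ^ 2 / ((k + 1 : ℕ) : ℝ) ^ 2 := by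
  simp only [hf.normalized.norm_logCoeff_succ_sq, hf.taylorCoeff_deriv_div_dslope h0,
    tsum_mul_left]

end StarSolution

theorem BriotBouquetSolution.norm_taylorCoeff_one (hψ : BriotBouquetSolution φ ψ)
    (hφ : DifferentiableAt ℂ φ 0) (h0 : φ 0 = 1) : ‖taylorCoeff φ 1‖ = 2 * ‖deriv ψ 0‖ := by
  have hone := hψ.one_add_mul_deriv_zero hφ
  rw [h0, one_mul, one_add_one_eq_two] at hone
  rw [taylorCoeff_one, ← hone, norm_mul, Complex.norm_two]

theorem sum_Icc_one_eq_sum_range (a : ℕ → ℝ) (n : ℕ) :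
    ∑ m ∈ Finset.Icc 1 n, a m = ∑ k ∈ Finset.range n, a (k + 1) := by
  rw [Finset.range_eq_Ico, Finset.sum_Ico_add', zero_add, Finset.Ico_add_one_right_eq_Icc]

end MaMinda

theorem mainTheorem7_general (φ ψ : ℂ → ℂ) (hφ : UnivalentOn φ disk)
    (hre : ∀ z ∈ disk, 0 < (φ z).re) (hφ0 : φ 0 = 1) (hφconv : Convex ℝ (φ '' disk))
    (hψ : BriotBouquetSolution φ ψ) :
    (Convex ℝ (ψ '' disk) → ∀ f : ℂ → ℂ, ConvexClass φ f →
      (∀ m : ℕ, 1 ≤ m → ‖logCoeff f m‖ ≤ ‖taylorCoeff φ 1‖ / (4 * m)) ∧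
      (∀ n : ℕ, ∑ m ∈ Finset.Icc 1 n, ‖logCoeff f m‖ ^ 2 ≤
        (1 / 4) * ∑ m ∈ Finset.Icc 1 n, ‖taylorCoeff ψ m‖ ^ 2 / (m : ℝ) ^ 2) ∧
      Summable (fun m : ℕ => ‖logCoeff f (m + 1)‖ ^ 2) ∧
      Summable (fun m : ℕ => ‖taylorCoeff ψ (m + 1)‖ ^ 2 / ((m + 1 : ℕ) : ℝ) ^ 2) ∧
      ∑' m : ℕ, ‖logCoeff f (m + 1)‖ ^ 2 ≤
        (1 / 4) * ∑' m : ℕ, ‖taylorCoeff ψ (m + 1)‖ ^ 2 / ((m + 1 : ℕ) : ℝ) ^ 2) ∧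
    (StarConvex ℝ 1 (ψ '' disk) → ∀ f : ℂ → ℂ, ConvexClass φ f →
      ∀ m : ℕ, 1 ≤ m → ‖logCoeff f m‖ ≤ ‖taylorCoeff φ 1‖ / 4) ∧
    (∃ f₀ : ℂ → ℂ, StarSolution ψ f₀) ∧
    (∀ f₀ : ℂ → ℂ, StarSolution ψ f₀ →
      ConvexClass φ f₀ ∧
      (∀ m : ℕ, 1 ≤ m → logCoeff f₀ m = taylorCoeff ψ m / (2 * m)) ∧
      (Convex ℝ (ψ '' disk) →
        ‖logCoeff f₀ 1‖ = ‖taylorCoeff φ 1‖ / 4 ∧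
        (∀ m : ℕ, 1 ≤ m → (‖logCoeff f₀ m‖ = ‖taylorCoeff φ 1‖ / (4 * m) ↔
          ‖taylorCoeff ψ m‖ = ‖taylorCoeff φ 1‖ / 2)) ∧
        ∑' m : ℕ, ‖logCoeff f₀ (m + 1)‖ ^ 2 =
          (1 / 4) * ∑' m : ℕ, ‖taylorCoeff ψ (m + 1)‖ ^ 2 / ((m + 1 : ℕ) : ℝ) ^ 2) ∧
      (StarConvex ℝ 1 (ψ '' disk) →
        ‖logCoeff f₀ 1‖ = ‖taylorCoeff φ 1‖ / 4 ∧
        (∀ m : ℕ, 1 ≤ m → (‖logCoeff f₀ m‖ = ‖taylorCoeff φ 1‖ / 4 ↔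
          ‖taylorCoeff ψ m‖ = m * ‖taylorCoeff φ 1‖ / 2)))) := by
  have hψu : UnivalentOn ψ disk := hψ.univalentOn hφ hφconv hre
  have hψ0 : ψ 0 = 1 := hψ.map_zero.trans hφ0
  have hB : ‖taylorCoeff φ 1‖ = 2 * ‖deriv ψ 0‖ :=
    hψ.norm_taylorCoeff_one (differentiableAt_of_mem_disk hφ.analytic zero_mem_disk) hφ0
  have hclass (f : ℂ → ℂ) (hf : ConvexClass φ f) : StarlikeClass ψ f :=
    hψ.starlikeClass hφ hφconv hre hf
  refine ⟨fun hconv f hf => ?_, fun hstar f hf m hm => ?_,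
    StarSolution.exists_of_differentiableOn hψ.analytic hψ0, fun f₀ hf₀ => ?_⟩
  · have hsum := hψu.summable_norm_taylorCoeff_sq_div hconv
    have hle := (hclass f hf).sum_norm_logCoeff_sq_le_tsum hψ.analytic hsum
    have hsumγ := (hclass f hf).summable_norm_logCoeff_sq hψ.analytic hsum
    refine ⟨fun m hm => ?_, fun n => ?_, hsumγ, hsum, hsumγ.tsum_le_of_sum_range_le hle⟩
    · exact ((hclass f hf).norm_logCoeff_le_of_convex hψu hconv hm).trans_eq (by rw [hB]; ring)
    · simpa only [sum_Icc_one_eq_sum_range] using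
        (hclass f hf).sum_norm_logCoeff_sq_le hψ.analytic n
  · exact ((hclass f hf).norm_logCoeff_le_of_starConvex hψu (hψ0 ▸ hstar) hm).trans_eq
      (by rw [hB]; ring)
  · have hone : ‖logCoeff f₀ 1‖ = ‖taylorCoeff φ 1‖ / 4 := by
      rw [hf₀.norm_logCoeff_one hψ0, hB]; ring
    refine ⟨hf₀.convexClass hψ hφ0, fun m hm => hf₀.logCoeff_eq hψ0 hm,
      fun _ => ⟨hone, fun m hm => ?_, hf₀.tsum_norm_logCoeff_sq hψ0⟩,
      fun _ => ⟨hone, fun m hm => ?_⟩⟩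
    · have hm0 : (m : ℝ) ≠ 0 := by positivity
      rw [hf₀.norm_logCoeff_eq_iff hψ0 hm, show ‖taylorCoeff φ 1‖ / (4 * m) * (2 * m) =
        ‖taylorCoeff φ 1‖ / 2 by field_simp; norm_num]
    · rw [hf₀.norm_logCoeff_eq_iff hψ0 hm]; ring_nf

theorem mainTheorem7 (φ ψ : ℂ → ℂ) (hφ : IsMaMinda φ) (hφconv : Convex ℝ (φ '' disk))
    (hψ : BriotBouquetSolution φ ψ) :
    -- the logarithmic coefficient bounds for convex `ψ`
    (Convex ℝ (ψ '' disk) → ∀ f : ℂ → ℂ, ConvexClass φ f →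
      (∀ m : ℕ, 1 ≤ m → ‖logCoeff f m‖ ≤ ‖taylorCoeff φ 1‖ / (4 * m)) ∧
      (∀ n : ℕ, ∑ m ∈ Finset.Icc 1 n, ‖logCoeff f m‖ ^ 2 ≤
        (1 / 4) * ∑ m ∈ Finset.Icc 1 n, ‖taylorCoeff ψ m‖ ^ 2 / (m : ℝ) ^ 2) ∧
      Summable (fun m : ℕ => ‖logCoeff f (m + 1)‖ ^ 2) ∧
      Summable (fun m : ℕ => ‖taylorCoeff ψ (m + 1)‖ ^ 2 / ((m + 1 : ℕ) : ℝ) ^ 2) ∧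
      ∑' m : ℕ, ‖logCoeff f (m + 1)‖ ^ 2 ≤
        (1 / 4) * ∑' m : ℕ, ‖taylorCoeff ψ (m + 1)‖ ^ 2 / ((m + 1 : ℕ) : ℝ) ^ 2) ∧
    -- the bound for `ψ` starlike with respect to `1`
    (StarConvex ℝ 1 (ψ '' disk) → ∀ f : ℂ → ℂ, ConvexClass φ f →
      ∀ m : ℕ, 1 ≤ m → ‖logCoeff f m‖ ≤ ‖taylorCoeff φ 1‖ / 4) ∧
    -- sharpness, for the function `f₀` with `z f₀' / f₀ = ψ`
    (∃ f₀ : ℂ → ℂ, StarSolution ψ f₀) ∧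
    (∀ f₀ : ℂ → ℂ, StarSolution ψ f₀ →
      ConvexClass φ f₀ ∧
      (∀ m : ℕ, 1 ≤ m → logCoeff f₀ m = taylorCoeff ψ m / (2 * m)) ∧
      (Convex ℝ (ψ '' disk) →
        ‖logCoeff f₀ 1‖ = ‖taylorCoeff φ 1‖ / 4 ∧
        (∀ m : ℕ, 1 ≤ m → (‖logCoeff f₀ m‖ = ‖taylorCoeff φ 1‖ / (4 * m) ↔
          ‖taylorCoeff ψ m‖ = ‖taylorCoeff φ 1‖ / 2)) ∧
        ∑' m : ℕ, ‖logCoeff f₀ (m + 1)‖ ^ 2 =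
          (1 / 4) * ∑' m : ℕ, ‖taylorCoeff ψ (m + 1)‖ ^ 2 / ((m + 1 : ℕ) : ℝ) ^ 2) ∧
      (StarConvex ℝ 1 (ψ '' disk) →
        ‖logCoeff f₀ 1‖ = ‖taylorCoeff φ 1‖ / 4 ∧
        (∀ m : ℕ, 1 ≤ m → (‖logCoeff f₀ m‖ = ‖taylorCoeff φ 1‖ / 4 ↔
          ‖taylorCoeff ψ m‖ = m * ‖taylorCoeff φ 1‖ / 2)))) :=
  mainTheorem7_general φ ψ ⟨Metric.isOpen_ball, hφ.analytic, hφ.univalent⟩ hφ.re_pos hφ.map_zero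
    hφconv hψ
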